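/- Let $(\bar M,\bar g)$ be a finite-dimensional smooth semi-Riemannian manifold of constant index with Levi-Civita connection $\bar\nabla$, and let $\bar J$ be a smooth $(1,1)$-tensor field with $\bar J^2=3\bar J+I$, $\bar g(X,\bar JY)=\bar g(\bar JX,Y)$ and $\bar\nabla\bar J=0$ (so $(\bar M,\bar g,\bar J)$ is a locally bronze semi-Riemannian manifold). Let $\eta$ be a smooth vector field with $\bar g(\eta,\eta)=1$, put $\theta(X)=\bar g(X,\eta)$, let $l,m$ be smooth functions on $\bar M$ with $(l,m)\neq(0,0)$, and let $\bar\Omega$ be the $(l,m)$-type connection $$\bar\Omega_XY=\bar\nabla_XY+\theta(Y)\{lX+m\bar JX\}.$$ Let $M$ be an $r$-lightlike submanifold of $\bar M$, that is, $\mathrm{Rad}\,TM=TM\cap TM^{\perp}$ is a smooth distribution of rank $r>0$. Fix a screen distribution $S(TM)$ (a smooth complement of $\mathrm{Rad}\,TM$ in $TM$), a screen transversal bundle $S(TM^\perp)$ (a smooth complement of $\mathrm{Rad}\,TM$ in $TM^\perp$), and a lightlike transversal bundle $\mathrm{ltr}(TM)$ (a smooth totally null complement of $\mathrm{Rad}\,TM$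 in $(S(TM)\oplus S(TM^\perp))^\perp$), so that $$T\bar M|_M=\mathrm{Rad}\,TM\oplus S(TM)\oplus \mathrm{ltr}(TM)\oplus S(TM^\perp).$$ Suppose that $M$ is screen generic: $\bar J(\mathrm{Rad}\,TM)=\mathrm{Rad}\,TM$, and $B_o=\bar J(S(TM))\cap S(TM)$ is a smooth nondegenerate distribution. Let $B'$ be the orthogonal complement of $B_o$ in $S(TM)$, again a smooth distribution. For a vector field $X$ on $M$ and a section $V$ of $S(TM)$, let $\Omega_XV$ be the $TM$-component of $\bar\Omega_XV$, let $\Omega^*_XV$ and $\bar h^*(X,V)$ be the components of $\Omega_XV$ in $S(TM)$ and in $\mathrm{Rad}\,TM$, and let $\bar h^s(X,V)$ be the component of $\bar\Omega_XV$ in $S(TM^\perp)$. For $Z$ tangent to $M$ let $fZ$ be the $TM$-component of $\bar JZ$. Then $B_o$ is integrable (that is, $[X,Y]\in\Gamma(B_o)$ for all $X,Y\in\Gamma(B_o)$) if and only if both of the following hold for all $X,Y\in\Gamma(B_o)$, $Z\in\Gamma(B')$ and $N\in\Gamma(\mathrm{ltr}(TM))$: (i) $\bar g(\bar h^*(X,\bar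 JY),\bar JN)+3\,\bar g(\bar h^*(Y,\bar JX),N)=\bar g(\bar h^*(Y,\bar JX),\bar JN)+3\,\bar g(\bar h^*(X,\bar JY),N)$; (ii) $\bar g(\Omega^*_X\bar JY,fZ)+\bar g(\bar h^s(X,\bar JY),\bar JZ)+3\,\bar g(\Omega^*_Y\bar JX,Z)=\bar g(\Omega^*_Y\bar JX,fZ)+\bar g(\bar h^s(Y,\bar JX),\bar JZ)+3\,\bar g(\Omega^*_X\bar JY,Z)$. -/

import Mathlib

open Bundle Set
open scoped Manifold ContDiff

noncomputable section

namespace Bronze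

universe uE uF uN uM

/-! ### Ambient geometry: semi-Riemannian metrics, bronze structures, connections -/

section Ambient

variable (E : Type uE) [NormedAddCommGroup E] [NormedSpace ℝ E]
  (N : Type uN) [TopologicalSpace N] [ChartedSpace E N] [IsManifold 𝓘(ℝ, E) ∞ N]

/-- A smooth semi-Riemannian metric on `N`: a smooth field of symmetric nondegenerate bilinear forms
on the tangent spaces, of constant index. -/
structure SemiRiemannianMetric where
  /-- the bilinear form on each tangent space -/
  val : ∀ p : N, TangentSpace 𝓘(ℝ, E) p →L[ℝ] TangentSpace 𝓘(ℝ, E) p →L[ℝ] ℝ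
  symm : ∀ (p : N) (u v : TangentSpace 𝓘(ℝ, E) p), val p u v = val p v u
  nondegenerate : ∀ (p : N) (u : TangentSpace 𝓘(ℝ, E) p), (∀ v, val p u v = 0) → u = 0
  contMDiff : ContMDiff 𝓘(ℝ, E) (𝓘(ℝ, E).prod 𝓘(ℝ, E →L[ℝ] E →L[ℝ] ℝ)) ∞
    (fun p ↦ TotalSpace.mk' (E →L[ℝ] E →L[ℝ] ℝ) p (val p))
  /-- the index: the maximal dimension of a subspace on which the form is negative definite -/
  index : ℕ
  index_eq : ∀ p : N,
    sigNeg (LinearMap.BilinMap.toQuadraticMap (R := ℝ)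
      (M := TangentSpace 𝓘(ℝ, E) p) (N := ℝ)
      ((ContinuousLinearMap.coeLM ℝ).comp (val p).toLinearMap)) = index

variable {E N}

/-- A `g`-compatible bronze structure: a smooth `(1,1)`-tensor field `J` with `J² = 3J + I` that is
self-adjoint for `g`. -/
structure BronzeStructure (g : SemiRiemannianMetric E N) where
  /-- the endomorphism of each tangent space -/
  val : ∀ p : N, TangentSpace 𝓘(ℝ, E) p →L[ℝ] TangentSpace 𝓘(ℝ, E) p
  contMDiff : ContMDiff 𝓘(ℝ, E) (𝓘(ℝ, E).prod 𝓘(ℝ, E →L[ℝ] E)) ∞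
    (fun p ↦ TotalSpace.mk' (E →L[ℝ] E) p (val p))
  sq : ∀ (p : N) (u : TangentSpace 𝓘(ℝ, E) p), val p (val p u) = (3 : ℝ) • val p u + u
  compatible : ∀ (p : N) (u v : TangentSpace 𝓘(ℝ, E) p), g.val p u (val p v) = g.val p (val p u) v

/-- A linear connection on `N`. Mathlib's argument order is `D Y p v = (D_v Y)(p)`. -/
abbrev LinearConnection (E : Type uE) [NormedAddCommGroup E] [NormedSpace ℝ E]
    (N : Type uN) [TopologicalSpace N] [ChartedSpace E N] [IsManifold 𝓘(ℝ, E) ∞ N] :=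
  CovariantDerivative 𝓘(ℝ, E) E (fun p : N ↦ TangentSpace 𝓘(ℝ, E) p)

/-- `D` is the Levi-Civita connection of `g`: it is torsion free and metric. -/
structure IsLeviCivita [FiniteDimensional ℝ E] (g : SemiRiemannianMetric E N)
    (D : LinearConnection E N) : Prop where
  torsion_free : D.torsion = 0
  metric : ∀ (Y Z : ∀ p : N, TangentSpace 𝓘(ℝ, E) p) (p : N) (v : TangentSpace 𝓘(ℝ, E) p),
    MDifferentiableAt 𝓘(ℝ, E) 𝓘(ℝ, E).tangent
      (fun q ↦ (⟨q, Y q⟩ : TangentBundle 𝓘(ℝ, E) N)) p →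
    MDifferentiableAt 𝓘(ℝ, E) 𝓘(ℝ, E).tangent
      (fun q ↦ (⟨q, Z q⟩ : TangentBundle 𝓘(ℝ, E) N)) p →
    mvfderiv 𝓘(ℝ, E) (fun q ↦ g.val q (Y q) (Z q)) p v
      = g.val p (D Y p v) (Z p) + g.val p (Y p) (D Z p v)

/-- `D J = 0`, that is, `D_v (J Y) = J (D_v Y)`. For the Levi-Civita connection `D` this says that
the bronze semi-Riemannian manifold is locally bronze. -/
def IsParallel {g : SemiRiemannianMetric E N} (D : LinearConnection E N)
    (J : BronzeStructure g) : Prop :=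
  ∀ (Y : ∀ p : N, TangentSpace 𝓘(ℝ, E) p) (p : N) (v : TangentSpace 𝓘(ℝ, E) p),
    MDifferentiableAt 𝓘(ℝ, E) 𝓘(ℝ, E).tangent
      (fun q ↦ (⟨q, Y q⟩ : TangentBundle 𝓘(ℝ, E) N)) p →
    D (fun q ↦ J.val q (Y q)) p v = J.val p (D Y p v)

/-- The connection `Ω_X Y = D_X Y + θ(Y) (l X + m J X)`, where `θ(Y) = g(Y, η)`; it is the
`(l, m)`-type connection determined by `l`, `m`, `η` when `D` is the Levi-Civita connection. -/
def lmConnection (g : SemiRiemannianMetric E N) (J : BronzeStructure g)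
    (D : LinearConnection E N) (η : ∀ p : N, TangentSpace 𝓘(ℝ, E) p) (l m : N → ℝ) :
    LinearConnection E N :=
  D.addOneForm fun p ↦
    (g.val p (η p)).smulRight
      (l p • ContinuousLinearMap.id ℝ (TangentSpace 𝓘(ℝ, E) p) + m p • J.val p)

end Ambient

/-! ### Sections along a map, subbundles, the pulled back connection -/

section Along

variable {E : Type uE} [NormedAddCommGroup E] [NormedSpace ℝ E]
  {N : Type uN} [TopologicalSpace N] [ChartedSpace E N] [IsManifold 𝓘(ℝ, E) ∞ N]
  {F : Type uF} [NormedAddCommGroup F] [NormedSpace ℝ F]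
  {M : Type uM} [TopologicalSpace M] [ChartedSpace F M]

/-- A smooth section of `TN` along `ι : M → N`, over the set `U ⊆ M`. -/
def IsSmoothAlongOn (F : Type uF) [NormedAddCommGroup F] [NormedSpace ℝ F]
    {M : Type uM} [TopologicalSpace M] [ChartedSpace F M] (ι : M → N)
    (V : ∀ x : M, TangentSpace 𝓘(ℝ, E) (ι x)) (U : Set M) : Prop :=
  ContMDiffOn 𝓘(ℝ, F) 𝓘(ℝ, E).tangent ∞
    (fun x ↦ (⟨ι x, V x⟩ : TangentBundle 𝓘(ℝ, E) N)) U

/-- A family of subspaces of the spaces `T_{ι x} N` is a smooth subbundle of rank `k` of `TN`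
along `ι` if it has local smooth frames with `k` elements. -/
def IsSubbundleAlong (F : Type uF) [NormedAddCommGroup F] [NormedSpace ℝ F]
    {M : Type uM} [TopologicalSpace M] [ChartedSpace F M] (ι : M → N) (k : ℕ)
    (D : ∀ x : M, Submodule ℝ (TangentSpace 𝓘(ℝ, E) (ι x))) : Prop :=
  ∀ x₀ : M, ∃ U : Set M, IsOpen U ∧ x₀ ∈ U ∧
    ∃ s : Fin k → ∀ x : M, TangentSpace 𝓘(ℝ, E) (ι x),
      (∀ i, IsSmoothAlongOn F ι (s i) U) ∧
      ∀ x ∈ U, LinearIndependent ℝ (fun i ↦ s i x) ∧ Submodule.span ℝ (range fun i ↦ s i x) = D x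

/-- `V ∈ Γ(D)`, for a family `D` of subspaces of the spaces `T_{ι x} N`. -/
def IsSection (F : Type uF) [NormedAddCommGroup F] [NormedSpace ℝ F]
    {M : Type uM} [TopologicalSpace M] [ChartedSpace F M] (ι : M → N)
    (D : ∀ x : M, Submodule ℝ (TangentSpace 𝓘(ℝ, E) (ι x)))
    (V : ∀ x : M, TangentSpace 𝓘(ℝ, E) (ι x)) : Prop :=
  IsSmoothAlongOn F ι V univ ∧ ∀ x, V x ∈ D x

/-- The vector field `X` on `M`, seen as a section of `TN` along `ι`. -/
def push (E : Type uE) [NormedAddCommGroup E] [NormedSpace ℝ E]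
    {N : Type uN} [TopologicalSpace N] [ChartedSpace E N] (ι : M → N)
    (X : ∀ x : M, TangentSpace 𝓘(ℝ, F) x) (x : M) : TangentSpace 𝓘(ℝ, E) (ι x) :=
  mfderiv 𝓘(ℝ, F) 𝓘(ℝ, E) ι x (X x)

/-- `J X`, for a vector field `X` on `M`, as a section of `TN` along `ι`. -/
def pushJ {g : SemiRiemannianMetric E N} (J : BronzeStructure g) (ι : M → N)
    (X : ∀ x : M, TangentSpace 𝓘(ℝ, F) x) (x : M) : TangentSpace 𝓘(ℝ, E) (ι x) :=
  J.val (ι x) (push E ι X x)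

/-- `X` is a smooth vector field on `M` that takes its values in the distribution `D`. -/
def IsTangentSection [IsManifold 𝓘(ℝ, F) ∞ M] (ι : M → N) (D : ∀ x : M, Submodule ℝ (TangentSpace 𝓘(ℝ, E) (ι x)))
    (X : ∀ x : M, TangentSpace 𝓘(ℝ, F) x) : Prop :=
  ContMDiff 𝓘(ℝ, F) 𝓘(ℝ, F).tangent ∞ (fun x ↦ (⟨x, X x⟩ : TangentBundle 𝓘(ℝ, F) M)) ∧
    ∀ x, push E ι X x ∈ D x

/-- A distribution on `M` is integrable if `[X, Y] ∈ Γ(D)` for all `X, Y ∈ Γ(D)`. -/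
def IsIntegrable (F : Type uF) [NormedAddCommGroup F] [NormedSpace ℝ F]
    {M : Type uM} [TopologicalSpace M] [ChartedSpace F M] [IsManifold 𝓘(ℝ, F) ∞ M]
    (ι : M → N)
    (D : ∀ x : M, Submodule ℝ (TangentSpace 𝓘(ℝ, E) (ι x))) : Prop :=
  ∀ X Y : ∀ x : M, TangentSpace 𝓘(ℝ, F) x, IsTangentSection ι D X → IsTangentSection ι D Y →
    ∀ x, push E ι (VectorField.mlieBracket 𝓘(ℝ, F) X Y) x ∈ D x

/-- The covariant derivative `D_v V` of a section `V` of `TN` along `ι`, in the direction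
`v ∈ T_x M`, for a connection `D` on `N`: if `V = ∑ Vⁱ (eᵢ ∘ ι)` near `x`, for the coordinate
frame `eᵢ` at `ι x`, then `D_v V = ∑ (dVⁱ(v) eᵢ + Vⁱ D_{dι v} eᵢ)`. -/
def covAlong [FiniteDimensional ℝ E] (D : LinearConnection E N) (ι : M → N)
    (V : ∀ x : M, TangentSpace 𝓘(ℝ, E) (ι x)) (x : M) (v : TangentSpace 𝓘(ℝ, F) x) :
    TangentSpace 𝓘(ℝ, E) (ι x) :=
  let e := trivializationAt E (fun p : N ↦ TangentSpace 𝓘(ℝ, E) p) (ι x)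
  let b := Module.finBasis ℝ E
  ∑ i, (mvfderiv 𝓘(ℝ, F) (fun y ↦ e.localFrameCoeff 𝓘(ℝ, E) b i (ι y) (V y)) x v
          • e.localFrame b i (ι x)
      + e.localFrameCoeff 𝓘(ℝ, E) b i (ι x) (V x)
          • D (e.localFrame b i) (ι x) (mfderiv 𝓘(ℝ, F) 𝓘(ℝ, E) ι x v))

end Along

/-! ### Lightlike submanifolds -/

section Lightlike

variable {E : Type uE} [NormedAddCommGroup E] [NormedSpace ℝ E]
  {N : Type uN} [TopologicalSpace N] [ChartedSpace E N] [IsManifold 𝓘(ℝ, E) ∞ N]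
  {F : Type uF} [NormedAddCommGroup F] [NormedSpace ℝ F]
  {M : Type uM} [TopologicalSpace M] [ChartedSpace F M]

/-- The `g`-orthogonal complement of a subspace of a tangent space. -/
def orth (g : SemiRiemannianMetric E N) {p : N} (D : Submodule ℝ (TangentSpace 𝓘(ℝ, E) p)) :
    Submodule ℝ (TangentSpace 𝓘(ℝ, E) p) where
  carrier := {v | ∀ u ∈ D, g.val p u v = 0}
  add_mem' := fun ha hb u hu ↦ by simp [ha u hu, hb u hu]
  zero_mem' := fun u _ ↦ by simp
  smul_mem' := fun c a ha u hu ↦ by simp [ha u hu]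

/-- The tangent space of `M` at `x`, inside `T_{ι x} N`. -/
def tangent (E : Type uE) [NormedAddCommGroup E] [NormedSpace ℝ E]
    {N : Type uN} [TopologicalSpace N] [ChartedSpace E N]
    (F : Type uF) [NormedAddCommGroup F] [NormedSpace ℝ F]
    {M : Type uM} [TopologicalSpace M] [ChartedSpace F M] (ι : M → N) (x : M) :
    Submodule ℝ (TangentSpace 𝓘(ℝ, E) (ι x)) :=
  LinearMap.range (mfderiv 𝓘(ℝ, F) 𝓘(ℝ, E) ι x).toLinearMap

/-- The radical space `Rad T_x M = T_x M ∩ (T_x M)^⊥`. -/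
def radical (F : Type uF) [NormedAddCommGroup F] [NormedSpace ℝ F]
    {M : Type uM} [TopologicalSpace M] [ChartedSpace F M]
    (g : SemiRiemannianMetric E N) (ι : M → N) (x : M) :
    Submodule ℝ (TangentSpace 𝓘(ℝ, E) (ι x)) :=
  tangent E F ι x ⊓ orth g (tangent E F ι x)

/-- An `r`-lightlike submanifold `(M, g, S(TM), S(TM^⊥))` of `(N, g)`, immersed by `ι`, with a
choice of lightlike transversal bundle `ltr(TM)`. -/
structure LightlikeSubmanifold (F : Type uF) [NormedAddCommGroup F] [NormedSpace ℝ F]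
    {M : Type uM} [TopologicalSpace M] [ChartedSpace F M]
    (g : SemiRiemannianMetric E N) (ι : M → N) where
  isImmersion : Manifold.IsImmersion 𝓘(ℝ, F) 𝓘(ℝ, E) ∞ ι
  /-- the rank of the radical distribution -/
  r : ℕ
  r_pos : 0 < r
  radical_subbundle : IsSubbundleAlong F ι r (radical F g ι)
  /-- the screen distribution `S(TM)`, a complement of `Rad TM` in `TM` -/
  screen : ∀ x : M, Submodule ℝ (TangentSpace 𝓘(ℝ, E) (ι x))
  screen_subbundle : ∃ k, IsSubbundleAlong F ι k screen
  screen_inf : ∀ x, radical F g ι x ⊓ screen x = ⊥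
  screen_sup : ∀ x, radical F g ι x ⊔ screen x = tangent E F ι x
  /-- the screen transversal bundle `S(TM^⊥)`, a complement of `Rad TM` in `TM^⊥` -/
  screenTrans : ∀ x : M, Submodule ℝ (TangentSpace 𝓘(ℝ, E) (ι x))
  screenTrans_subbundle : ∃ k, IsSubbundleAlong F ι k screenTrans
  screenTrans_inf : ∀ x, radical F g ι x ⊓ screenTrans x = ⊥
  screenTrans_sup : ∀ x, radical F g ι x ⊔ screenTrans x = orth g (tangent E F ι x)
  /-- the lightlike transversal bundle `ltr(TM)`: a totally null complement of `Rad TM` in the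
  orthogonal complement of `S(TM) ⊕ S(TM^⊥)` -/
  ltr : ∀ x : M, Submodule ℝ (TangentSpace 𝓘(ℝ, E) (ι x))
  ltr_subbundle : IsSubbundleAlong F ι r ltr
  ltr_inf : ∀ x, radical F g ι x ⊓ ltr x = ⊥
  ltr_sup : ∀ x, radical F g ι x ⊔ ltr x = orth g (screen x ⊔ screenTrans x)
  ltr_null : ∀ x, ∀ u ∈ ltr x, ∀ v ∈ ltr x, g.val (ι x) u v = 0
  /-- `TN|_M = TM ⊕ tr(TM)`, where `tr(TM) = ltr(TM) ⊕ S(TM^⊥)` -/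
  isCompl_tangent : ∀ x, IsCompl (tangent E F ι x) (ltr x ⊔ screenTrans x)

namespace LightlikeSubmanifold

variable {g : SemiRiemannianMetric E N} {ι : M → N} (S : LightlikeSubmanifold F g ι) (x : M)

theorem disjoint_ltr_screenTrans : Disjoint (S.ltr x) (S.screenTrans x) := by
  rw [Submodule.disjoint_def]
  intro u hu hu'
  have hT : u ∈ orth g (tangent E F ι x) := by
    rw [← S.screenTrans_sup x]; exact Submodule.mem_sup_right hu'
  have hL : u ∈ orth g (S.screen x ⊔ S.screenTrans x) := by
    rw [← S.ltr_sup x]; exact Submodule.mem_sup_right hu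
  have htop : (⊤ : Submodule ℝ (TangentSpace 𝓘(ℝ, E) (ι x))) ≤ orth g (Submodule.span ℝ {u}) := by
    rw [← (S.isCompl_tangent x).sup_eq_top]
    have key : ∀ v, g.val (ι x) u v = 0 → v ∈ orth g (Submodule.span ℝ {u}) := by
      intro v hv w hw
      obtain ⟨c, rfl⟩ := Submodule.mem_span_singleton.mp hw
      simp [hv]
    refine sup_le (fun v hv ↦ key v ?_) (sup_le (fun v hv ↦ key v ?_) (fun v hv ↦ key v ?_))
    · rw [g.symm]; exact hT v hv
    · exact S.ltr_null x u hu v hv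
    · rw [g.symm]; exact hL v (Submodule.mem_sup_right hv)
  refine g.nondegenerate (ι x) u fun v ↦ ?_
  exact htop (Submodule.mem_top : v ∈ ⊤) u (Submodule.mem_span_singleton_self u)

theorem isCompl_screenTrans : IsCompl (S.screenTrans x) (tangent E F ι x ⊔ S.ltr x) :=
  (((S.disjoint_ltr_screenTrans x).isCompl_sup_left_of_isCompl_sup_right
    (S.isCompl_tangent x))).symm

theorem isCompl_screen : IsCompl (S.screen x)
    (radical F g ι x ⊔ (S.ltr x ⊔ S.screenTrans x)) := by
  have h := S.isCompl_tangent x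
  rw [← S.screen_sup x, sup_comm] at h
  exact (disjoint_iff.mpr (S.screen_inf x)).symm.isCompl_sup_right_of_isCompl_sup_left h

theorem isCompl_radical : IsCompl (radical F g ι x)
    (S.screen x ⊔ (S.ltr x ⊔ S.screenTrans x)) := by
  have h := S.isCompl_tangent x
  rw [← S.screen_sup x] at h
  exact (disjoint_iff.mpr (S.screen_inf x)).isCompl_sup_right_of_isCompl_sup_left h

/-- The projection of `TN|_M = Rad TM ⊕ S(TM) ⊕ ltr(TM) ⊕ S(TM^⊥)` onto `TM = Rad TM ⊕ S(TM)`,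
along `tr(TM) = ltr(TM) ⊕ S(TM^⊥)`. -/
def tangentPart : TangentSpace 𝓘(ℝ, E) (ι x) →ₗ[ℝ] TangentSpace 𝓘(ℝ, E) (ι x) :=
  (tangent E F ι x).projection _ (S.isCompl_tangent x)

/-- The projection onto `Rad TM`, along the sum of the other summands of `TN|_M`. -/
def radicalPart : TangentSpace 𝓘(ℝ, E) (ι x) →ₗ[ℝ] TangentSpace 𝓘(ℝ, E) (ι x) :=
  (radical F g ι x).projection _ (S.isCompl_radical x)

/-- The projection onto `S(TM)`, along the sum of the other summands of `TN|_M`. -/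
def screenPart : TangentSpace 𝓘(ℝ, E) (ι x) →ₗ[ℝ] TangentSpace 𝓘(ℝ, E) (ι x) :=
  (S.screen x).projection _ (S.isCompl_screen x)

/-- The projection onto `S(TM^⊥)`, along the sum of the other summands of `TN|_M`. -/
def screenTransPart : TangentSpace 𝓘(ℝ, E) (ι x) →ₗ[ℝ] TangentSpace 𝓘(ℝ, E) (ι x) :=
  (S.screenTrans x).projection _ (S.isCompl_screenTrans x)

/-- The tangential part `f v` of `J v`. -/
def f (J : BronzeStructure g) (v : TangentSpace 𝓘(ℝ, E) (ι x)) : TangentSpace 𝓘(ℝ, E) (ι x) :=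
  S.tangentPart x (J.val (ι x) v)

variable [FiniteDimensional ℝ E] (Ω : LinearConnection E N)
  (X : ∀ x : M, TangentSpace 𝓘(ℝ, F) x) (V : ∀ x : M, TangentSpace 𝓘(ℝ, E) (ι x))

/-- The connection on `M` induced by a connection `Ω` of `N`: the tangential part of `Ω_X V`. -/
def inducedConnection : TangentSpace 𝓘(ℝ, E) (ι x) :=
  S.tangentPart x (covAlong Ω ι V x (X x))

/-- The screen second fundamental form `h^s(X, V)`: the `S(TM^⊥)`-part of `Ω_X V`. -/
def screenSecondForm : TangentSpace 𝓘(ℝ, E) (ι x) :=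
  S.screenTransPart x (covAlong Ω ι V x (X x))

/-- The connection `Ω^*_X V`, for `V` in `S(TM)`: the `S(TM)`-part of the induced connection. -/
def screenConnection : TangentSpace 𝓘(ℝ, E) (ι x) :=
  S.screenPart x (S.inducedConnection x Ω X V)

/-- The form `h^*(X, V)`, for `V` in `S(TM)`: the `Rad TM`-part of the induced connection. -/
def radicalForm : TangentSpace 𝓘(ℝ, E) (ι x) :=
  S.radicalPart x (S.inducedConnection x Ω X V)

end LightlikeSubmanifold

/-- The distribution `B₀ = J(S(TM)) ∩ S(TM)`. -/
def LightlikeSubmanifold.B₀ {g : SemiRiemannianMetric E N} {ι : M → N}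
    (S : LightlikeSubmanifold F g ι) (J : BronzeStructure g) (x : M) :
    Submodule ℝ (TangentSpace 𝓘(ℝ, E) (ι x)) :=
  (S.screen x).map (J.val (ι x)).toLinearMap ⊓ S.screen x

/-- A screen generic lightlike submanifold: `Rad TM` is `J`-invariant, and
`B₀ = J(S(TM)) ∩ S(TM)` is a nondegenerate distribution; `B'` is its orthogonal complement
in `S(TM)`. -/
structure ScreenGenericLightlikeSubmanifold (F : Type uF) [NormedAddCommGroup F] [NormedSpace ℝ F]
    {M : Type uM} [TopologicalSpace M] [ChartedSpace F M]
    (g : SemiRiemannianMetric E N) (J : BronzeStructure g) (ι : M → N)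
    extends LightlikeSubmanifold F g ι where
  radical_invariant : ∀ x, (radical F g ι x).map (J.val (ι x)).toLinearMap = radical F g ι x
  B₀_subbundle : ∃ k, IsSubbundleAlong F ι k (toLightlikeSubmanifold.B₀ J)
  B₀_nondegenerate : ∀ x, toLightlikeSubmanifold.B₀ J x ⊓ orth g (toLightlikeSubmanifold.B₀ J x) = ⊥
  /-- the complementary distribution `B'` -/
  Bprime : ∀ x : M, Submodule ℝ (TangentSpace 𝓘(ℝ, E) (ι x))
  Bprime_subbundle : ∃ k, IsSubbundleAlong F ι k Bprime
  Bprime_eq : ∀ x, Bprime x = screen x ⊓ orth g (toLightlikeSubmanifold.B₀ J x)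

end Lightlike

end Bronze

end

noncomputable section

namespace Bronze

open scoped Topology

/-! ### The Lie bracket of vector fields as a commutator of derivations -/

section Bracket

variable {F : Type*} [NormedAddCommGroup F] [NormedSpace ℝ F]
    {M : Type*} [TopologicalSpace M] [ChartedSpace F M] [IsManifold 𝓘(ℝ, F) ∞ M]

/-! Let `X`, `Y` be sections of `B₀` and `w = Ω_X JY - Ω_Y JX` along `ι`. The Levi-Civita connection
is torsion free and `J` is parallel, so its contribution to `w` is exactly `J[X, Y]`. The terms with
`l`, `m`, `θ` are combinations of `X`, `Y`, `JX`, `JY`, and `B₀` is `J`-invariant, so `w = J[X, Y] +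
β` with `β` in `B₀` (`covAlong_lmConnection_pushJ_sub`).

What remains is linear algebra in one tangent space (`mem_B₀_iff`): for `v` tangent and `w = Jv +
β`, decide from the parts of `w` whether `v ∈ B₀`. The bronze equation reads `J(J - 3) = I`, so `J -
3` is the inverse of `J`; it is self-adjoint. Pairing `w` with `(J - 3)z` for `z ∈ B'` therefore
gives `g(v, z)`, and (ii) says that `v` is orthogonal to `B'`, that is, that the screen part of `v`
lies in `B₀`. Since `Rad TM` and `ltr(TM)` are dual under `g`, (i) says that the radical part `a` of
`w` satisfies `(J - 3)a = 0`, hence `a = 0`; as `Rad TM` is `J`-invariant, this kills the radical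
part of `v`.

Two passages link geometry and algebra. The bracket identity along an immersion is proved in
coordinates (`covAlong_push_sub`, `covAlong_bronze`), and conditions on sections of `ltr(TM)` and
`B'` become conditions on single vectors because every vector extends to a global section
(`exists_isSection_apply_eq`). -/

theorem fderiv_apply_sub_fderiv_apply_eq_fderiv_lieBracket {f : F → ℝ} {X Y : F → F} {z : F}
    (hf : ContDiffAt ℝ 2 f z) (hX : DifferentiableAt ℝ X z) (hY : DifferentiableAt ℝ Y z) :
    fderiv ℝ (fun w ↦ fderiv ℝ f w (Y w)) z (X z) - fderiv ℝ (fun w ↦ fderiv ℝ f w (X w)) z (Y z)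
      = fderiv ℝ f z (VectorField.lieBracket ℝ X Y z) := by
  have hf' : DifferentiableAt ℝ (fderiv ℝ f) z :=
    (hf.fderiv_right (m := 1) (by norm_num)).differentiableAt (by norm_num)
  have hs : IsSymmSndFDerivAt ℝ f z := hf.isSymmSndFDerivAt (by simp)
  rw [fderiv_clm_apply hf' hY, fderiv_clm_apply hf' hX]
  simp [VectorField.lieBracket, hs.eq (X z) (Y z)]

/-- Pulling `V` back applies the inverse of the differential of the inverse chart, and the chain
rule for `f` applies that differential again, so the two cancel. -/
theorem fderiv_comp_extChartAt_symm {f : M → ℝ} {V : ∀ x : M, TangentSpace 𝓘(ℝ, F) x} (x : M)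
    {z : F} (hz : z ∈ (extChartAt 𝓘(ℝ, F) x).target)
    (hf : MDifferentiableAt 𝓘(ℝ, F) 𝓘(ℝ) f ((extChartAt 𝓘(ℝ, F) x).symm z)) :
    fderiv ℝ (f ∘ (extChartAt 𝓘(ℝ, F) x).symm) z
        (VectorField.mpullbackWithin 𝓘(ℝ, F) 𝓘(ℝ, F) (extChartAt 𝓘(ℝ, F) x).symm V
          (range 𝓘(ℝ, F)) z)
      = mvfderiv 𝓘(ℝ, F) f ((extChartAt 𝓘(ℝ, F) x).symm z)
          (V ((extChartAt 𝓘(ℝ, F) x).symm z)) := by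
  have : IsManifold 𝓘(ℝ, F) 1 M := IsManifold.of_le (n := ∞) (by norm_num)
  have hi := isInvertible_mfderivWithin_extChartAt_symm (I := 𝓘(ℝ, F)) hz
  have hd : MDifferentiableWithinAt 𝓘(ℝ, F) 𝓘(ℝ, F) (extChartAt 𝓘(ℝ, F) x).symm
    (range 𝓘(ℝ, F)) z := mdifferentiableWithinAt_extChartAt_symm hz
  rw [VectorField.mpullbackWithin_apply]
  set A := mfderivWithin 𝓘(ℝ, F) 𝓘(ℝ, F) (extChartAt 𝓘(ℝ, F) x).symm (range 𝓘(ℝ, F)) z with hA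
  have hr : range 𝓘(ℝ, F) = univ := by simp
  have h1 : fderiv ℝ (f ∘ (extChartAt 𝓘(ℝ, F) x).symm) z
      = (mvfderiv 𝓘(ℝ, F) f ((extChartAt 𝓘(ℝ, F) x).symm z)).comp A := by
    rw [hA]
    rw [← mfderiv_eq_fderiv]
    rw [hr, mfderivWithin_univ]
    rw [hr, mdifferentiableWithinAt_univ] at hd
    exact mvfderiv_comp z hf hd
  rw [h1]
  exact congrArg _ (hi.self_apply_inverse _)

/-- `X (Y f) - Y (X f) = [X, Y] f`. -/
theorem mvfderiv_mvfderiv_sub [CompleteSpace F] {f : M → ℝ} {X Y : ∀ x : M, TangentSpace 𝓘(ℝ, F) x} {x : M}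
    (hf : ContMDiffAt 𝓘(ℝ, F) 𝓘(ℝ) 2 f x)
    (hX : MDifferentiableAt 𝓘(ℝ, F) 𝓘(ℝ, F).tangent
      (fun x ↦ (⟨x, X x⟩ : TangentBundle 𝓘(ℝ, F) M)) x)
    (hY : MDifferentiableAt 𝓘(ℝ, F) 𝓘(ℝ, F).tangent
      (fun x ↦ (⟨x, Y x⟩ : TangentBundle 𝓘(ℝ, F) M)) x)
    (hfX : MDifferentiableAt 𝓘(ℝ, F) 𝓘(ℝ) (fun y ↦ mvfderiv 𝓘(ℝ, F) f y (X y)) x)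
    (hfY : MDifferentiableAt 𝓘(ℝ, F) 𝓘(ℝ) (fun y ↦ mvfderiv 𝓘(ℝ, F) f y (Y y)) x) :
    mvfderiv 𝓘(ℝ, F) (fun y ↦ mvfderiv 𝓘(ℝ, F) f y (Y y)) x (X x)
      - mvfderiv 𝓘(ℝ, F) (fun y ↦ mvfderiv 𝓘(ℝ, F) f y (X y)) x (Y x)
      = mvfderiv 𝓘(ℝ, F) f x (VectorField.mlieBracket 𝓘(ℝ, F) X Y x) := by
  have : IsManifold 𝓘(ℝ, F) 2 M := IsManifold.of_le (n := ∞) 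
    (mod_cast le_top : ((2 : ℕ∞) : ℕ∞ω) ≤ ∞)
  have : IsManifold 𝓘(ℝ, F) 1 M := IsManifold.of_le (n := ∞) (by norm_num)
  have hX' := MDifferentiableWithinAt.differentiableWithinAt_mpullbackWithin_vectorField
    (mdifferentiableWithinAt_univ.2 hX)
  have hY' := MDifferentiableWithinAt.differentiableWithinAt_mpullbackWithin_vectorField
    (mdifferentiableWithinAt_univ.2 hY)
  have hr : range 𝓘(ℝ, F) = univ := by simp
  replace hX' := hX'.differentiableAt (by simp)
  replace hY' := hY'.differentiableAt (by simp)
  have hz : extChartAt 𝓘(ℝ, F) x x ∈ (extChartAt 𝓘(ℝ, F) x).target := mem_extChartAt_target x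
  have hxx : (extChartAt 𝓘(ℝ, F) x).symm (extChartAt 𝓘(ℝ, F) x x) = x := extChartAt_to_inv x
  have hfc : ContDiffAt ℝ 2 (f ∘ (extChartAt 𝓘(ℝ, F) x).symm) (extChartAt 𝓘(ℝ, F) x x) := by
    have h := (contMDiffAt_iff.1 hf).2
    rw [hr, contDiffWithinAt_univ] at h
    exact h
  -- The inner derivative is differentiated once more, so its chart expression is needed on a whole
  -- neighbourhood.
  have hev : ∀ᶠ z in 𝓝 (extChartAt 𝓘(ℝ, F) x x), z ∈ (extChartAt 𝓘(ℝ, F) x).target ∧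
      MDifferentiableAt 𝓘(ℝ, F) 𝓘(ℝ) f ((extChartAt 𝓘(ℝ, F) x).symm z) := by
    refine Filter.Eventually.and (extChartAt_target_mem_nhds x) ?_
    have h1 : ∀ᶠ y in 𝓝 x, MDifferentiableAt 𝓘(ℝ, F) 𝓘(ℝ) f y := by
      filter_upwards [(contMDiffAt_iff_contMDiffAt_nhds (by simp)).1 hf] with y hy
        using hy.mdifferentiableAt two_ne_zero
    have h2 := continuousAt_extChartAt_symm (I := 𝓘(ℝ, F)) x
    rw [ContinuousAt, hxx] at h2
    exact h2.eventually h1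
  have key : ∀ (V W : ∀ x : M, TangentSpace 𝓘(ℝ, F) x)
      (_ : MDifferentiableAt 𝓘(ℝ, F) 𝓘(ℝ) (fun y ↦ mvfderiv 𝓘(ℝ, F) f y (W y)) x),
      mvfderiv 𝓘(ℝ, F) (fun y ↦ mvfderiv 𝓘(ℝ, F) f y (W y)) x (V x)
      = fderiv ℝ (fun z ↦ fderiv ℝ (f ∘ (extChartAt 𝓘(ℝ, F) x).symm) z
          (VectorField.mpullbackWithin 𝓘(ℝ, F) 𝓘(ℝ, F) (extChartAt 𝓘(ℝ, F) x).symm W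
          (range 𝓘(ℝ, F)) z)) (extChartAt 𝓘(ℝ, F) x x)
          (VectorField.mpullbackWithin 𝓘(ℝ, F) 𝓘(ℝ, F) (extChartAt 𝓘(ℝ, F) x).symm V
          (range 𝓘(ℝ, F)) (extChartAt 𝓘(ℝ, F) x x)) := by
    intro V W hW
    have h1 := fderiv_comp_extChartAt_symm (V := V) x hz (hxx.symm ▸ hW)
    rw [hxx] at h1
    rw [← h1]
    congr 1
    apply Filter.EventuallyEq.fderiv_eq
    filter_upwards [hev] with z hz'
    exact (fderiv_comp_extChartAt_symm x hz'.1 hz'.2).symm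
  rw [key X Y hfY, key Y X hfX]
  refine (fderiv_apply_sub_fderiv_apply_eq_fderiv_lieBracket hfc hX' hY').trans ?_
  -- The bracket on `M` is, by definition, the bracket of the chart pullbacks carried back by the
  -- inverse differential of the chart; `hcomp` supplies the differential that cancels this inverse.
  rw [← VectorField.mlieBracketWithin_univ, VectorField.mlieBracketWithin_apply]
  simp only [preimage_univ, univ_inter]
  have hi := isInvertible_mfderiv_extChartAt (I := 𝓘(ℝ, F)) (mem_extChartAt_source (I := 𝓘(ℝ, F)) x)
  have hcomp : mvfderiv 𝓘(ℝ, F) f x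
      = (fderiv ℝ (f ∘ (extChartAt 𝓘(ℝ, F) x).symm) (extChartAt 𝓘(ℝ, F) x x)).comp
        (mfderiv 𝓘(ℝ, F) 𝓘(ℝ, F) (extChartAt 𝓘(ℝ, F) x) x) := by
    have h1 : f =ᶠ[𝓝 x] (f ∘ (extChartAt 𝓘(ℝ, F) x).symm) ∘ extChartAt 𝓘(ℝ, F) x := by
      filter_upwards [extChartAt_source_mem_nhds (I := 𝓘(ℝ, F)) x] with y hy
      exact (congrArg f ((extChartAt 𝓘(ℝ, F) x).left_inv hy)).symm
    have h2 : mfderiv 𝓘(ℝ, F) 𝓘(ℝ) f x = mfderiv 𝓘(ℝ, F) 𝓘(ℝ)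
      ((f ∘ (extChartAt 𝓘(ℝ, F) x).symm) ∘ extChartAt 𝓘(ℝ, F) x) x := h1.mfderiv_eq
    have h3 := mfderiv_comp x (hfc.differentiableAt (by norm_num)).mdifferentiableAt
      (mdifferentiableAt_extChartAt (I := 𝓘(ℝ, F)) (mem_chart_source F x))
    rw [mfderiv_eq_fderiv] at h3
    exact h2.trans h3
  rw [hcomp]
  have hlb : ∀ (A B : F → F) (z : F), VectorField.lieBracketWithin ℝ A B (range 𝓘(ℝ, F)) z
      = VectorField.lieBracket ℝ A B z := by
    intro A B z
    rw [hr, VectorField.lieBracketWithin_univ]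
  exact (congrArg _ ((hi.self_apply_inverse _).trans (hlb _ _ _))).symm

end Bracket

/-! ### Coordinate frames and their coefficients -/

section Frame
variable {E : Type*} [NormedAddCommGroup E] [NormedSpace ℝ E]
  {N : Type*} [TopologicalSpace N] [ChartedSpace E N] [IsManifold 𝓘(ℝ, E) ∞ N]
  {κ : Type*} (b : Module.Basis κ ℝ E)
  (e : Trivialization E (TotalSpace.proj : TangentBundle 𝓘(ℝ, E) N → N))
  [MemTrivializationAtlas e]
  {p : N}
theorem localFrameCoeff_apply (hp : p ∈ e.baseSet) (i : κ) (v : TangentSpace 𝓘(ℝ, E) p) :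
    e.localFrameCoeff 𝓘(ℝ, E) b i p v = b.repr (e ⟨p, v⟩).2 i := by
  classical
  -- The single vector `v` is extended by zero to a section; no continuity is needed, since the
  -- coefficient at `p` sees only the value there.
  simpa using e.localFrameCoeff_eq_coeff (I := 𝓘(ℝ, E)) (b := b)
    (s := Function.update (fun q : N ↦ (0 : TangentSpace 𝓘(ℝ, E) q)) p v) (i := i) hp

theorem sum_localFrameCoeff_smul [Fintype κ] (hp : p ∈ e.baseSet) (v : TangentSpace 𝓘(ℝ, E) p) :
    ∑ i, e.localFrameCoeff 𝓘(ℝ, E) b i p v • e.localFrame b i p = v := by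
  classical
  simpa using (e.eq_sum_localFrameCoeff_smul (I := 𝓘(ℝ, E)) (b := b)
    (s := Function.update (fun q : N ↦ (0 : TangentSpace 𝓘(ℝ, E) q)) p v) hp).symm

theorem localFrameCoeff_localFrame [DecidableEq κ] (hp : p ∈ e.baseSet) (i j : κ) :
    e.localFrameCoeff 𝓘(ℝ, E) b i p (e.localFrame b j p) = if j = i then 1 else 0 := by
  rw [e.localFrameCoeff_apply_of_mem_baseSet b hp (e.localFrame b j) i,
    e.localFrame_apply_of_mem_baseSet b hp, Module.Basis.repr_self, Finsupp.single_apply]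

/-- The `i`-th coordinate function of the chart of `N` at `p₀`, in a basis of the model space. -/
def chartCoord (p₀ : N) (i : κ) (q : N) : ℝ :=
  b.repr (extChartAt 𝓘(ℝ, E) p₀ q) i

theorem contMDiffAt_chartCoord [FiniteDimensional ℝ E] {p₀ : N} (i : κ) (hp : p ∈ (chartAt E p₀).source) :
    ContMDiffAt 𝓘(ℝ, E) 𝓘(ℝ) ∞ (chartCoord b p₀ i) p := by
  have h : ContMDiff 𝓘(ℝ, E) 𝓘(ℝ) ∞ (LinearMap.toContinuousLinearMap (b.coord i)) :=
    (LinearMap.toContinuousLinearMap (b.coord i)).contMDiff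
  exact h.contMDiffAt.comp p (contMDiffAt_extChartAt' hp)

/-- The preferred trivialization of the tangent bundle is the differential of the chart, so the dual
frame consists of the differentials of the coordinates. -/
theorem localFrameCoeff_trivializationAt [FiniteDimensional ℝ E] {p₀ : N} (i : κ) (hp : p ∈ (chartAt E p₀).source)
    (v : TangentSpace 𝓘(ℝ, E) p) :
    (trivializationAt E (fun p : N ↦ TangentSpace 𝓘(ℝ, E) p) p₀).localFrameCoeff 𝓘(ℝ, E) b i p v
      = mvfderiv 𝓘(ℝ, E) (chartCoord b p₀ i) p v := by
  have hp' : p ∈ (trivializationAt E (fun p : N ↦ TangentSpace 𝓘(ℝ, E) p) p₀).baseSet := by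
    simpa using hp
  have : IsManifold 𝓘(ℝ, E) 1 N := IsManifold.of_le (n := ∞) (by norm_num)
  rw [localFrameCoeff_apply b _ hp']
  have h1 := TangentBundle.continuousLinearMapAt_trivializationAt (I := 𝓘(ℝ, E)) hp
  have h2 := mfderiv_comp p
    (I := 𝓘(ℝ, E)) (I' := 𝓘(ℝ, E)) (I'' := 𝓘(ℝ))
    (g := LinearMap.toContinuousLinearMap (b.coord i)) (f := extChartAt 𝓘(ℝ, E) p₀)
    (LinearMap.toContinuousLinearMap (b.coord i)).mdifferentiableAt
    (mdifferentiableAt_extChartAt hp)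
  rw [ContinuousLinearMap.mfderiv_eq, ← h1] at h2
  have h3 := congrArg (fun A ↦ A v) h2
  refine Eq.trans ?_ h3.symm
  change _ = b.repr ((trivializationAt E (TangentSpace 𝓘(ℝ, E)) p₀).continuousLinearMapAt ℝ p v) i
  rw [Trivialization.continuousLinearMapAt_apply, Trivialization.linearMapAt_apply, if_pos hp']

end Frame

/-! ### Calculus of connections in a local frame -/

section Frame
variable {E : Type*} [NormedAddCommGroup E] [NormedSpace ℝ E]
  {N : Type*} [TopologicalSpace N] [ChartedSpace E N] [IsManifold 𝓘(ℝ, E) ∞ N]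
  {F : Type*} [NormedAddCommGroup F] [NormedSpace ℝ F]
  {M : Type*} [TopologicalSpace M] [ChartedSpace F M]
  {κ : Type*} (b : Module.Basis κ ℝ E)
  (e : Trivialization E (TotalSpace.proj : TangentBundle 𝓘(ℝ, E) N → N))
  [MemTrivializationAtlas e]

theorem contMDiffAt_localFrameCoeff_along [FiniteDimensional ℝ E] {ι : M → N} {V : ∀ x : M, TangentSpace 𝓘(ℝ, E) (ι x)}
    {x : M} (hx : ι x ∈ e.baseSet)
    (hV : ContMDiffAt 𝓘(ℝ, F) 𝓘(ℝ, E).tangent ∞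
      (fun x ↦ (⟨ι x, V x⟩ : TangentBundle 𝓘(ℝ, E) N)) x) (i : κ) :
    ContMDiffAt 𝓘(ℝ, F) 𝓘(ℝ) ∞ (fun y ↦ e.localFrameCoeff 𝓘(ℝ, E) b i (ι y) (V y)) x := by
  have hs : (⟨ι x, V x⟩ : TangentBundle 𝓘(ℝ, E) N) ∈ e.source := e.mem_source.2 hx
  have h := (e.contMDiffAt_iff (f := fun x ↦ (⟨ι x, V x⟩ : TangentBundle 𝓘(ℝ, E) N)) hs).1 hV
  have hL : ContMDiff 𝓘(ℝ, E) 𝓘(ℝ) ∞ (LinearMap.toContinuousLinearMap (b.coord i)) :=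
    (LinearMap.toContinuousLinearMap (b.coord i)).contMDiff
  refine (hL.contMDiffAt.comp x h.2).congr_of_eventuallyEq ?_
  filter_upwards [h.1.continuousAt.preimage_mem_nhds (e.open_baseSet.mem_nhds hx)] with y hy
  exact localFrameCoeff_apply b e hy i (V y)

theorem mvfderiv_finset_sum {κ : Type*} {s : Finset κ} {f : κ → M → ℝ} {x : M}
    (hf : ∀ i ∈ s, MDifferentiableAt 𝓘(ℝ, F) 𝓘(ℝ) (f i) x) (v : TangentSpace 𝓘(ℝ, F) x) :
    mvfderiv 𝓘(ℝ, F) (fun y ↦ ∑ i ∈ s, f i y) x v = ∑ i ∈ s, mvfderiv 𝓘(ℝ, F) (f i) x v := by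
  classical
  suffices h : MDifferentiableAt 𝓘(ℝ, F) 𝓘(ℝ) (fun y ↦ ∑ i ∈ s, f i y) x ∧
      mvfderiv 𝓘(ℝ, F) (fun y ↦ ∑ i ∈ s, f i y) x v = ∑ i ∈ s, mvfderiv 𝓘(ℝ, F) (f i) x v from h.2
  induction s using Finset.induction_on with
  | empty => simpa [mvfderiv_const] using mdifferentiableAt_const
  | insert a s ha ih =>
    obtain ⟨h1, h2⟩ := ih fun i hi ↦ hf i (Finset.mem_insert_of_mem hi)
    have h3 := hf a (Finset.mem_insert_self a s)
    simp only [Finset.sum_insert ha]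
    exact ⟨h3.add h1, by rw [mvfderiv_fun_add h3 h1, add_apply, h2]⟩

theorem covariantDerivative_sum_smul (D : LinearConnection E N) {s : Finset κ} {a : κ → N → ℝ}
    {Y : κ → ∀ p : N, TangentSpace 𝓘(ℝ, E) p} {p : N}
    (ha : ∀ i ∈ s, MDifferentiableAt 𝓘(ℝ, E) 𝓘(ℝ) (a i) p)
    (hY : ∀ i ∈ s, MDifferentiableAt 𝓘(ℝ, E) 𝓘(ℝ, E).tangent
      (fun q ↦ (⟨q, Y i q⟩ : TangentBundle 𝓘(ℝ, E) N)) p) (w : TangentSpace 𝓘(ℝ, E) p) :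
    D (fun q ↦ ∑ i ∈ s, a i q • Y i q) p w
      = ∑ i ∈ s, (a i p • D (Y i) p w + mvfderiv 𝓘(ℝ, E) (a i) p w • Y i p) := by
  classical
  induction s using Finset.induction_on with
  | empty =>
    have h : (fun q : N ↦ ∑ i ∈ (∅ : Finset κ), a i q • Y i q) = 0 := by ext; simp
    rw [h, D.zero]; simp
  | insert c s hc ih =>
    have h1 := ih (fun i hi ↦ ha i (Finset.mem_insert_of_mem hi))
      fun i hi ↦ hY i (Finset.mem_insert_of_mem hi)
    have ha' := ha c (Finset.mem_insert_self c s)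
    have hY' := hY c (Finset.mem_insert_self c s)
    have h2 : (fun q : N ↦ ∑ i ∈ insert c s, a i q • Y i q)
        = a c • Y c + fun q ↦ ∑ i ∈ s, a i q • Y i q := by
      ext q; simp [Finset.sum_insert hc]
    have h3 : MDifferentiableAt 𝓘(ℝ, E) 𝓘(ℝ, E).tangent
        (fun q ↦ (⟨q, ∑ i ∈ s, a i q • Y i q⟩ : TangentBundle 𝓘(ℝ, E) N)) p :=
      MDifferentiableAt.sum_section (t := fun i q ↦ a i q • Y i q) fun i hi ↦
        (ha i (Finset.mem_insert_of_mem hi)).smul_section (hY i (Finset.mem_insert_of_mem hi))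
    rw [h2, D.isCovariantDerivativeOnUniv.add (ha'.smul_section hY') h3,
      add_apply, h1, D.isCovariantDerivativeOnUniv.leibniz hY' ha',
      Finset.sum_insert hc]
    rfl

theorem mdifferentiableAt_localFrame {p : N} (hp : p ∈ e.baseSet) (i : κ) :
    MDifferentiableAt 𝓘(ℝ, E) 𝓘(ℝ, E).tangent
      (fun q ↦ (⟨q, e.localFrame b i q⟩ : TangentBundle 𝓘(ℝ, E) N)) p :=
  (contMDiffAt_localFrame_of_mem (n := ∞) e b i hp).mdifferentiableAt (by simp)

/-- Symmetry of the Christoffel symbols. Without torsion the difference is the bracket of two frame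
fields. Each frame field has constant derivative 0 or 1 on each coordinate function near `p`, so the
bracket annihilates all coordinates and vanishes. -/
theorem covariantDerivative_localFrame_comm [FiniteDimensional ℝ E] [Fintype κ]
    {D : LinearConnection E N}
    (hD : D.torsion = 0) (p : N) (i j : κ) :
    let e := trivializationAt E (fun p : N ↦ TangentSpace 𝓘(ℝ, E) p) p
    D (e.localFrame b j) p (e.localFrame b i p) = D (e.localFrame b i) p (e.localFrame b j p) := by
  classical
  intro e
  have hp : p ∈ e.baseSet := mem_baseSet_trivializationAt E _ p
  have h := D.torsion_eq_zero_iff.1 hD (mdifferentiableAt_localFrame b e hp i)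
    (mdifferentiableAt_localFrame b e hp j)
  rw [← sub_eq_zero, h, ← sum_localFrameCoeff_smul b e hp (VectorField.mlieBracket _ _ _ p)]
  refine Finset.sum_eq_zero fun k _ ↦ ?_
  have hc : ∀ l : κ, ∀ᶠ q in 𝓝 p, mvfderiv 𝓘(ℝ, E) (chartCoord b p k) q (e.localFrame b l q)
      = if l = k then 1 else 0 := by
    intro l
    filter_upwards [e.open_baseSet.mem_nhds hp] with q hq
    rw [← localFrameCoeff_trivializationAt b k (by simpa [e] using hq)]
    exact localFrameCoeff_localFrame b e hq k l
  have hd : ∀ l : κ, MDifferentiableAt 𝓘(ℝ, E) 𝓘(ℝ)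
      (fun q ↦ mvfderiv 𝓘(ℝ, E) (chartCoord b p k) q (e.localFrame b l q)) p := fun l ↦
    mdifferentiableAt_const.congr_of_eventuallyEq (hc l)
  have h0 : ∀ l : κ, mvfderiv 𝓘(ℝ, E)
      (fun q ↦ mvfderiv 𝓘(ℝ, E) (chartCoord b p k) q (e.localFrame b l q)) p = 0 := by
    intro l
    have h1 := Filter.EventuallyEq.mfderiv_eq (I := 𝓘(ℝ, E)) (I' := 𝓘(ℝ)) (hc l)
    refine Eq.trans ?_ (mvfderiv_const (I := 𝓘(ℝ, E)) (x := p) (if l = k then (1 : ℝ) else 0))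
    exact h1
  have h2 := mvfderiv_mvfderiv_sub
    ((contMDiffAt_chartCoord b k (mem_chart_source E p)).of_le
      (mod_cast le_top : ((2 : ℕ∞) : ℕ∞ω) ≤ ∞))
    (mdifferentiableAt_localFrame b e hp i) (mdifferentiableAt_localFrame b e hp j) (hd i) (hd j)
  rw [h0, h0] at h2
  rw [localFrameCoeff_trivializationAt b k (mem_chart_source E p), ← h2]
  simp

end Frame

/-! ### Covariant derivatives along a map -/

section Along
variable {E : Type*} [NormedAddCommGroup E] [NormedSpace ℝ E] [FiniteDimensional ℝ E]
  {N : Type*} [TopologicalSpace N] [ChartedSpace E N] [IsManifold 𝓘(ℝ, E) ∞ N]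
  {F : Type*} [NormedAddCommGroup F] [NormedSpace ℝ F]
  {M : Type*} [TopologicalSpace M] [ChartedSpace F M]

theorem covAlong_eq_sum (D : LinearConnection E N) (ι : M → N)
    (V : ∀ x : M, TangentSpace 𝓘(ℝ, E) (ι x)) (x : M) (v : TangentSpace 𝓘(ℝ, F) x)
    {e : Trivialization E (TotalSpace.proj : TangentBundle 𝓘(ℝ, E) N → N)}
    [MemTrivializationAtlas e]
    (he : e = trivializationAt E (fun p : N ↦ TangentSpace 𝓘(ℝ, E) p) (ι x)) :
    covAlong D ι V x v = ∑ i, (mvfderiv 𝓘(ℝ, F)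
        (fun y ↦ e.localFrameCoeff 𝓘(ℝ, E) (Module.finBasis ℝ E) i (ι y) (V y)) x v
          • e.localFrame (Module.finBasis ℝ E) i (ι x)
      + e.localFrameCoeff 𝓘(ℝ, E) (Module.finBasis ℝ E) i (ι x) (V x)
          • D (e.localFrame (Module.finBasis ℝ E) i) (ι x)
              (mfderiv 𝓘(ℝ, F) 𝓘(ℝ, E) ι x v)) := by
  subst he; rfl

/-- A torsion-free connection satisfies `D_X (dι Y) - D_Y (dι X) = dι [X, Y]` along a smooth
map `ι`. -/
theorem covAlong_push_sub [CompleteSpace F] [IsManifold 𝓘(ℝ, F) ∞ M] {D : LinearConnection E N}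
    (hD : D.torsion = 0) {ι : M → N} (hι : ContMDiff 𝓘(ℝ, F) 𝓘(ℝ, E) ∞ ι)
    {X Y : ∀ x : M, TangentSpace 𝓘(ℝ, F) x} {x : M}
    (hX : ContMDiffAt 𝓘(ℝ, F) 𝓘(ℝ, F).tangent ∞
      (fun x ↦ (⟨x, X x⟩ : TangentBundle 𝓘(ℝ, F) M)) x)
    (hY : ContMDiffAt 𝓘(ℝ, F) 𝓘(ℝ, F).tangent ∞
      (fun x ↦ (⟨x, Y x⟩ : TangentBundle 𝓘(ℝ, F) M)) x)
    (hX' : ContMDiffAt 𝓘(ℝ, F) 𝓘(ℝ, E).tangent ∞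
      (fun x ↦ (⟨ι x, push E ι X x⟩ : TangentBundle 𝓘(ℝ, E) N)) x)
    (hY' : ContMDiffAt 𝓘(ℝ, F) 𝓘(ℝ, E).tangent ∞
      (fun x ↦ (⟨ι x, push E ι Y x⟩ : TangentBundle 𝓘(ℝ, E) N)) x) :
    covAlong D ι (push E ι Y) x (X x) - covAlong D ι (push E ι X) x (Y x)
      = push E ι (VectorField.mlieBracket 𝓘(ℝ, F) X Y) x := by
  classical
  set e := trivializationAt E (fun p : N ↦ TangentSpace 𝓘(ℝ, E) p) (ι x) with he
  simp only [covAlong_eq_sum _ ι _ x _ he]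
  set b := Module.finBasis ℝ E
  have hp : ι x ∈ e.baseSet := mem_baseSet_trivializationAt E _ (ι x)
  have hev : ∀ᶠ y in 𝓝 x, ι y ∈ e.baseSet :=
    hι.continuous.continuousAt.preimage_mem_nhds (e.open_baseSet.mem_nhds hp)
  have hcoef : ∀ (i) (y : M) (_ : ι y ∈ e.baseSet) (u : TangentSpace 𝓘(ℝ, F) y),
      e.localFrameCoeff 𝓘(ℝ, E) b i (ι y) (mfderiv 𝓘(ℝ, F) 𝓘(ℝ, E) ι y u)
        = mvfderiv 𝓘(ℝ, F) (chartCoord b (ι x) i ∘ ι) y u := by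
    intro i y hy u
    have hy' : ι y ∈ (chartAt E (ι x)).source := by simpa [e] using hy
    rw [localFrameCoeff_trivializationAt b i hy',
      mvfderiv_comp_apply y ((contMDiffAt_chartCoord b i hy').mdifferentiableAt (by simp))
        (hι.contMDiffAt.mdifferentiableAt (by simp))]
  -- The coefficients of `dι Y` are the derivatives by `Y` of the coordinates composed with `ι`;
  -- their antisymmetrized derivatives are thus the coefficients of `dι [X, Y]`.
  have hbr : ∀ i, mvfderiv 𝓘(ℝ, F)
        (fun y ↦ e.localFrameCoeff 𝓘(ℝ, E) b i (ι y) (push E ι Y y)) x (X x)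
      - mvfderiv 𝓘(ℝ, F)
        (fun y ↦ e.localFrameCoeff 𝓘(ℝ, E) b i (ι y) (push E ι X y)) x (Y x)
      = e.localFrameCoeff 𝓘(ℝ, E) b i (ι x)
        (push E ι (VectorField.mlieBracket 𝓘(ℝ, F) X Y) x) := by
    intro i
    have hf : ContMDiffAt 𝓘(ℝ, F) 𝓘(ℝ) 2 (chartCoord b (ι x) i ∘ ι) x :=
      ((contMDiffAt_chartCoord b i (mem_chart_source E (ι x))).comp x hι.contMDiffAt).of_le
        (mod_cast le_top : ((2 : ℕ∞) : ℕ∞ω) ≤ ∞)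
    have hc : ∀ V : ∀ x : M, TangentSpace 𝓘(ℝ, F) x,
        (fun y ↦ e.localFrameCoeff 𝓘(ℝ, E) b i (ι y) (push E ι V y)) =ᶠ[𝓝 x]
          fun y ↦ mvfderiv 𝓘(ℝ, F) (chartCoord b (ι x) i ∘ ι) y (V y) := by
      intro V
      filter_upwards [hev] with y hy using hcoef i y hy (V y)
    have hd : ∀ V : ∀ x : M, TangentSpace 𝓘(ℝ, F) x, ContMDiffAt 𝓘(ℝ, F) 𝓘(ℝ, E).tangent ∞
        (fun x ↦ (⟨ι x, push E ι V x⟩ : TangentBundle 𝓘(ℝ, E) N)) x →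
        MDifferentiableAt 𝓘(ℝ, F) 𝓘(ℝ)
          (fun y ↦ mvfderiv 𝓘(ℝ, F) (chartCoord b (ι x) i ∘ ι) y (V y)) x := by
      intro V hV
      exact ((contMDiffAt_localFrameCoeff_along b e hp hV i).mdifferentiableAt
        (by simp)).congr_of_eventuallyEq (hc V).symm
    have hm : ∀ V : ∀ x : M, TangentSpace 𝓘(ℝ, F) x, mvfderiv 𝓘(ℝ, F)
        (fun y ↦ e.localFrameCoeff 𝓘(ℝ, E) b i (ι y) (push E ι V y)) x
        = mvfderiv 𝓘(ℝ, F) (fun y ↦ mvfderiv 𝓘(ℝ, F) (chartCoord b (ι x) i ∘ ι) y (V y)) x :=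
      fun V ↦ (hc V).mfderiv_eq
    rw [hm, hm, mvfderiv_mvfderiv_sub hf (hX.mdifferentiableAt (by simp))
      (hY.mdifferentiableAt (by simp)) (hd X hX') (hd Y hY')]
    exact (hcoef i x hp _).symm
  have hexp : ∀ (W : TangentSpace 𝓘(ℝ, E) (ι x)) (i), D (e.localFrame b i) (ι x) W
      = ∑ j, e.localFrameCoeff 𝓘(ℝ, E) b j (ι x) W
        • D (e.localFrame b i) (ι x) (e.localFrame b j (ι x)) := by
    intro W i
    conv_lhs => rw [← sum_localFrameCoeff_smul b e hp W]
    rw [map_sum]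
    simp only [map_smul]
  -- By symmetry of the Christoffel symbols the zeroth-order terms of the two covariant derivatives
  -- agree and drop out of the difference.
  have hsym : ∑ i, e.localFrameCoeff 𝓘(ℝ, E) b i (ι x) (push E ι Y x)
        • D (e.localFrame b i) (ι x) (push E ι X x)
      = ∑ i, e.localFrameCoeff 𝓘(ℝ, E) b i (ι x) (push E ι X x)
        • D (e.localFrame b i) (ι x) (push E ι Y x) := by
    simp only [hexp (push E ι X x), hexp (push E ι Y x), Finset.smul_sum]
    rw [Finset.sum_comm]
    refine Finset.sum_congr rfl fun i _ ↦ Finset.sum_congr rfl fun j _ ↦ ?_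
    rw [smul_comm, covariantDerivative_localFrame_comm b hD (ι x) i j]
  change ∑ i, (_ + _ • D (e.localFrame b i) (ι x) (push E ι X x))
    - ∑ i, (_ + _ • D (e.localFrame b i) (ι x) (push E ι Y x)) = _
  rw [Finset.sum_add_distrib, Finset.sum_add_distrib, hsym, add_sub_add_right_eq_sub,
    ← Finset.sum_sub_distrib]
  simp only [← sub_smul, hbr]
  exact sum_localFrameCoeff_smul b e hp _

/-- Parallelism concerns fields on `N`, while `V` lives only along `ι` and need not come from such a
field. It is therefore applied to the frame fields: with the matrix `A` of `J` in the frame, both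
sides expand by the Leibniz rule into the same double sum. -/
theorem covAlong_bronze {g : SemiRiemannianMetric E N} (J : BronzeStructure g)
    {D : LinearConnection E N} (hJ : IsParallel D J) {ι : M → N}
    {V : ∀ x : M, TangentSpace 𝓘(ℝ, E) (ι x)} {x : M}
    (hι : ContMDiff 𝓘(ℝ, F) 𝓘(ℝ, E) ∞ ι)
    (hV : ContMDiffAt 𝓘(ℝ, F) 𝓘(ℝ, E).tangent ∞
      (fun x ↦ (⟨ι x, V x⟩ : TangentBundle 𝓘(ℝ, E) N)) x) (v : TangentSpace 𝓘(ℝ, F) x) :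
    covAlong D ι (fun y ↦ J.val (ι y) (V y)) x v = J.val (ι x) (covAlong D ι V x v) := by
  classical
  set e := trivializationAt E (fun p : N ↦ TangentSpace 𝓘(ℝ, E) p) (ι x) with he
  simp only [covAlong_eq_sum _ ι _ x _ he]
  set b := Module.finBasis ℝ E
  set w := mfderiv 𝓘(ℝ, F) 𝓘(ℝ, E) ι x v
  have hp : ι x ∈ e.baseSet := mem_baseSet_trivializationAt E _ (ι x)
  have hev : ∀ᶠ y in 𝓝 x, ι y ∈ e.baseSet :=
    hι.continuous.continuousAt.preimage_mem_nhds (e.open_baseSet.mem_nhds hp)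
  let A : Fin (Module.finrank ℝ E) → Fin (Module.finrank ℝ E) → N → ℝ := fun i j q ↦
    e.localFrameCoeff 𝓘(ℝ, E) b j q (J.val q (e.localFrame b i q))
  let c : Fin (Module.finrank ℝ E) → M → ℝ := fun i y ↦
    e.localFrameCoeff 𝓘(ℝ, E) b i (ι y) (V y)
  have hJe : ∀ i, ContMDiffAt 𝓘(ℝ, E) 𝓘(ℝ, E).tangent ∞
      (fun q ↦ (⟨q, J.val q (e.localFrame b i q)⟩ : TangentBundle 𝓘(ℝ, E) N)) (ι x) := fun i ↦
    ContMDiffAt.clm_bundle_apply (b := fun q : N ↦ q) J.contMDiff.contMDiffAt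
      (contMDiffAt_localFrame_of_mem (n := ∞) e b i hp)
  have hA : ∀ i j, MDifferentiableAt 𝓘(ℝ, E) 𝓘(ℝ) (A i j) (ι x) := fun i j ↦
    (contMDiffAt_localFrameCoeff_along b e (ι := fun q : N ↦ q) hp (hJe i) j).mdifferentiableAt
      (by simp)
  have hc : ∀ i, MDifferentiableAt 𝓘(ℝ, F) 𝓘(ℝ) (c i) x := fun i ↦
    (contMDiffAt_localFrameCoeff_along b e hp hV i).mdifferentiableAt (by simp)
  have hιx : MDifferentiableAt 𝓘(ℝ, F) 𝓘(ℝ, E) ι x := hι.contMDiffAt.mdifferentiableAt (by simp)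
  have hJA : ∀ i, ∀ q ∈ e.baseSet, J.val q (e.localFrame b i q)
      = ∑ j, A i j q • e.localFrame b j q := fun i q hq ↦
    (sum_localFrameCoeff_smul b e hq _).symm
  have hcJ : ∀ (j) (y : M) (_ : ι y ∈ e.baseSet),
      e.localFrameCoeff 𝓘(ℝ, E) b j (ι y) (J.val (ι y) (V y)) = ∑ i, c i y * A i j (ι y) := by
    intro j y hy
    conv_lhs => rw [← sum_localFrameCoeff_smul b e hy (V y)]
    simp only [map_sum, map_smul, smul_eq_mul, c, A]
  have hd : ∀ j, mvfderiv 𝓘(ℝ, F)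
      (fun y ↦ e.localFrameCoeff 𝓘(ℝ, E) b j (ι y) (J.val (ι y) (V y))) x v
      = ∑ i, (c i x * mvfderiv 𝓘(ℝ, E) (A i j) (ι x) w
        + A i j (ι x) * mvfderiv 𝓘(ℝ, F) (c i) x v) := by
    intro j
    have h1 : (fun y ↦ e.localFrameCoeff 𝓘(ℝ, E) b j (ι y) (J.val (ι y) (V y))) =ᶠ[𝓝 x]
        fun y ↦ ∑ i, c i y * A i j (ι y) := by
      filter_upwards [hev] with y hy using hcJ j y hy
    have h2 : mvfderiv 𝓘(ℝ, F)
      (fun y ↦ e.localFrameCoeff 𝓘(ℝ, E) b j (ι y) (J.val (ι y) (V y))) x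
      = mvfderiv 𝓘(ℝ, F) (fun y ↦ ∑ i, c i y * A i j (ι y)) x := h1.mfderiv_eq
    have h3 : ∀ i, MDifferentiableAt 𝓘(ℝ, F) 𝓘(ℝ) (fun y ↦ A i j (ι y)) x := fun i ↦
      (hA i j).comp x hιx
    rw [h2, mvfderiv_finset_sum (f := fun i y ↦ c i y * A i j (ι y))
      fun i _ ↦ (hc i).mul (h3 i)]
    refine Finset.sum_congr rfl fun i _ ↦ ?_
    rw [mvfderiv_fun_mul (hc i) (h3 i)]
    have h4 : mvfderiv 𝓘(ℝ, F) (fun y ↦ A i j (ι y)) x v = mvfderiv 𝓘(ℝ, E) (A i j) (ι x) w :=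
      mvfderiv_comp_apply x (hA i j) hιx v
    simp [h4]
  have hDJ : ∀ i, J.val (ι x) (D (e.localFrame b i) (ι x) w)
      = ∑ j, (A i j (ι x) • D (e.localFrame b j) (ι x) w
        + mvfderiv 𝓘(ℝ, E) (A i j) (ι x) w • e.localFrame b j (ι x)) := by
    intro i
    rw [← hJ _ _ _ (mdifferentiableAt_localFrame b e hp i),
      ← covariantDerivative_sum_smul D (fun j _ ↦ hA i j)
        fun j _ ↦ mdifferentiableAt_localFrame b e hp j]
    congr 1
    refine D.isCovariantDerivativeOnUniv.congr_of_eventuallyEq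
      ((hJe i).mdifferentiableAt (by simp)) ?_ Filter.univ_mem ?_
    · exact MDifferentiableAt.sum_section (t := fun j q ↦ A i j q • e.localFrame b j q)
        fun j _ ↦ (hA i j).smul_section (mdifferentiableAt_localFrame b e hp j)
    · filter_upwards [e.open_baseSet.mem_nhds hp] with q hq using hJA i q hq
  simp only [map_sum, map_add, map_smul, hd, hcJ _ x hp, hDJ, hJA _ _ hp]
  calc _ = ∑ j, ∑ i, ((c i x * mvfderiv 𝓘(ℝ, E) (A i j) (ι x) w
          + A i j (ι x) * mvfderiv 𝓘(ℝ, F) (c i) x v) • e.localFrame b j (ι x)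
        + (c i x * A i j (ι x)) • D (e.localFrame b j) (ι x) w) := by
        refine Finset.sum_congr rfl fun j _ ↦ ?_
        rw [Finset.sum_smul, Finset.sum_smul]
        exact Finset.sum_add_distrib.symm
    _ = ∑ i, ∑ j, ((c i x * mvfderiv 𝓘(ℝ, E) (A i j) (ι x) w
          + A i j (ι x) * mvfderiv 𝓘(ℝ, F) (c i) x v) • e.localFrame b j (ι x)
        + (c i x * A i j (ι x)) • D (e.localFrame b j) (ι x) w) := Finset.sum_comm
    _ = _ := by
        refine Finset.sum_congr rfl fun i _ ↦ ?_
        simp only [Finset.smul_sum, ← Finset.sum_add_distrib]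
        refine Finset.sum_congr rfl fun j _ ↦ ?_
        change _ = mvfderiv 𝓘(ℝ, F) (c i) x v • A i j (ι x) • _ + c i x • _
        module

/-- The added term is tensorial in the differentiated field, so summing it over the frame
reassembles `θ(V)`. -/
theorem covAlong_lmConnection {g : SemiRiemannianMetric E N} (J : BronzeStructure g)
    (D : LinearConnection E N) (η : ∀ p : N, TangentSpace 𝓘(ℝ, E) p) (l m : N → ℝ) (ι : M → N)
    (V : ∀ x : M, TangentSpace 𝓘(ℝ, E) (ι x)) (x : M) (v : TangentSpace 𝓘(ℝ, F) x) :
    covAlong (lmConnection g J D η l m) ι V x v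
      = covAlong D ι V x v + g.val (ι x) (η (ι x)) (V x)
        • (l (ι x) • mfderiv 𝓘(ℝ, F) 𝓘(ℝ, E) ι x v
          + m (ι x) • J.val (ι x) (mfderiv 𝓘(ℝ, F) 𝓘(ℝ, E) ι x v)) := by
  set e := trivializationAt E (fun p : N ↦ TangentSpace 𝓘(ℝ, E) p) (ι x) with he
  simp only [covAlong_eq_sum _ ι _ x _ he]
  set b := Module.finBasis ℝ E
  have hp : ι x ∈ e.baseSet := mem_baseSet_trivializationAt E _ (ι x)
  have h : ∀ i, lmConnection g J D η l m (e.localFrame b i) (ι x)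
      (mfderiv 𝓘(ℝ, F) 𝓘(ℝ, E) ι x v)
      = D (e.localFrame b i) (ι x) (mfderiv 𝓘(ℝ, F) 𝓘(ℝ, E) ι x v)
        + g.val (ι x) (η (ι x)) (e.localFrame b i (ι x))
        • (l (ι x) • mfderiv 𝓘(ℝ, F) 𝓘(ℝ, E) ι x v
          + m (ι x) • J.val (ι x) (mfderiv 𝓘(ℝ, F) 𝓘(ℝ, E) ι x v)) := fun i ↦ rfl
  have hV := congrArg (g.val (ι x) (η (ι x))) (sum_localFrameCoeff_smul b e hp (V x))
  rw [map_sum] at hV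
  simp only [map_smul, smul_eq_mul] at hV
  simp only [h]
  rw [← hV, Finset.sum_smul, ← Finset.sum_add_distrib]
  refine Finset.sum_congr rfl fun i _ ↦ ?_
  rw [smul_add, mul_smul, add_assoc]

end Along

/-! ### Extending vectors to global sections -/

section Sections
variable {E : Type*} [NormedAddCommGroup E] [NormedSpace ℝ E]
  {N : Type*} [TopologicalSpace N] [ChartedSpace E N] [IsManifold 𝓘(ℝ, E) ∞ N]
  {F : Type*} [NormedAddCommGroup F] [NormedSpace ℝ F]
  {M : Type*} [TopologicalSpace M] [ChartedSpace F M]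

theorem contMDiff_push [IsManifold 𝓘(ℝ, F) ∞ M] {ι : M → N} (hι : ContMDiff 𝓘(ℝ, F) 𝓘(ℝ, E) ∞ ι)
    {X : ∀ x : M, TangentSpace 𝓘(ℝ, F) x}
    (hX : ContMDiff 𝓘(ℝ, F) 𝓘(ℝ, F).tangent ∞
      (fun x ↦ (⟨x, X x⟩ : TangentBundle 𝓘(ℝ, F) M))) :
    ContMDiff 𝓘(ℝ, F) 𝓘(ℝ, E).tangent ∞
      (fun x ↦ (⟨ι x, push E ι X x⟩ : TangentBundle 𝓘(ℝ, E) N)) :=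
  (hι.contMDiff_tangentMap (m := ∞) (by simp)).comp hX

/-- A constant-coefficient combination of a local frame, cut off by a bump function. -/
theorem exists_isSection_apply_eq [FiniteDimensional ℝ F] [T2Space M] [IsManifold 𝓘(ℝ, F) ∞ M]
    {ι : M → N} (hι : ContMDiff 𝓘(ℝ, F) 𝓘(ℝ, E) ∞ ι) {k : ℕ}
    {D : ∀ x : M, Submodule ℝ (TangentSpace 𝓘(ℝ, E) (ι x))} (hD : IsSubbundleAlong F ι k D)
    {x₀ : M} {u : TangentSpace 𝓘(ℝ, E) (ι x₀)} (hu : u ∈ D x₀) :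
    ∃ V, IsSection F ι D V ∧ V x₀ = u := by
  obtain ⟨U, hUo, hxU, s, hs, hsD⟩ := hD x₀
  rw [← (hsD x₀ hxU).2, Submodule.mem_span_range_iff_exists_fun] at hu
  obtain ⟨c, hc⟩ := hu
  set e := trivializationAt E (fun p : N ↦ TangentSpace 𝓘(ℝ, E) p) (ι x₀)
  have hbase : IsOpen (ι ⁻¹' e.baseSet) := e.open_baseSet.preimage hι.continuous
  have he : ι x₀ ∈ e.baseSet := mem_baseSet_trivializationAt E _ (ι x₀)
  have hx₀ : x₀ ∈ U ∩ ι ⁻¹' e.baseSet := ⟨hxU, he⟩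
  -- The support lies where the frame is smooth and where one trivialization of `TN` reads off the
  -- values.
  obtain ⟨f, -, hf⟩ := (SmoothBumpFunction.nhds_basis_tsupport (I := 𝓘(ℝ, F)) x₀).mem_iff.1
    ((hUo.inter hbase).mem_nhds hx₀)
  refine ⟨fun x ↦ f x • ∑ i, c i • s i x, ⟨?_, fun x ↦ ?_⟩, ?_⟩
  · refine ContMDiff.contMDiffOn fun y ↦ ?_
    by_cases hy : y ∈ tsupport f
    · have hyU := (hf hy).1
      have hys : (⟨ι y, f y • ∑ i, c i • s i y⟩ : TangentBundle 𝓘(ℝ, E) N) ∈ e.source :=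
        e.mem_source.2 (hf hy).2
      refine (e.contMDiffAt_iff
        (f := fun x ↦ (⟨ι x, f x • ∑ i, c i • s i x⟩ : TangentBundle 𝓘(ℝ, E) N)) hys).2
        ⟨hι.contMDiffAt, ?_⟩
      have hsi : ∀ i, ContMDiffAt 𝓘(ℝ, F) 𝓘(ℝ, E) ∞
          (fun x ↦ (e (⟨ι x, s i x⟩ : TangentBundle 𝓘(ℝ, E) N)).2) y := fun i ↦
        ((e.contMDiffAt_iff (f := fun x ↦ (⟨ι x, s i x⟩ : TangentBundle 𝓘(ℝ, E) N))
          (e.mem_source.2 (hf hy).2)).1 ((hs i).contMDiffAt (hUo.mem_nhds hyU))).2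
      have hsum : ContMDiffAt 𝓘(ℝ, F) 𝓘(ℝ, E) ∞
          (fun x ↦ f x • ∑ i, c i • (e (⟨ι x, s i x⟩ : TangentBundle 𝓘(ℝ, E) N)).2) y :=
        f.contMDiffAt.smul (contMDiffAt_finsetSum fun i _ ↦
          (contMDiffAt_const (I' := 𝓘(ℝ)) (c := c i)).smul (hsi i))
      refine hsum.congr_of_eventuallyEq ?_
      filter_upwards [hbase.mem_nhds (hf hy).2] with z hz
      have hlin : ∀ v, (e (⟨ι z, v⟩ : TangentBundle 𝓘(ℝ, E) N)).2 = e.linearMapAt ℝ (ι z) v :=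
        fun v ↦ by rw [Trivialization.linearMapAt_apply, if_pos (mem_preimage.1 hz)]
      simp only [hlin, map_smul, map_sum]
    · have hzero : ContMDiff 𝓘(ℝ, F) 𝓘(ℝ, E).tangent ∞
          (fun x ↦ (⟨ι x, 0⟩ : TangentBundle 𝓘(ℝ, E) N)) :=
        (contMDiff_zeroSection ℝ (fun p : N ↦ TangentSpace 𝓘(ℝ, E) p)).comp hι
      refine hzero.contMDiffAt.congr_of_eventuallyEq ?_
      filter_upwards [(isClosed_tsupport f).isOpen_compl.mem_nhds hy] with z hz
      rw [image_eq_zero_of_notMem_tsupport hz, zero_smul]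
  · by_cases hx : x ∈ tsupport f
    · rw [← (hsD x (hf hx).1).2]
      exact Submodule.smul_mem _ _ (Submodule.sum_mem _ fun i _ ↦
        Submodule.smul_mem _ _ (Submodule.subset_span (mem_range_self i)))
    · simp only [image_eq_zero_of_notMem_tsupport hx, zero_smul, Submodule.zero_mem]
  · simp only [f.eq_one, one_smul, hc]

end Sections

/-! ### Linear algebra in one tangent space -/

section Pointwise
variable {E : Type*} [NormedAddCommGroup E] [NormedSpace ℝ E]
  {N : Type*} [TopologicalSpace N] [ChartedSpace E N] [IsManifold 𝓘(ℝ, E) ∞ N]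
  {F : Type*} [NormedAddCommGroup F] [NormedSpace ℝ F]
  {M : Type*} [TopologicalSpace M] [ChartedSpace F M]
  {g : SemiRiemannianMetric E N} {J : BronzeStructure g} {ι : M → N}

theorem inner_tangent_radical {x : M} {u v : TangentSpace 𝓘(ℝ, E) (ι x)}
    (hu : u ∈ tangent E F ι x) (hv : v ∈ radical F g ι x) :
    g.val (ι x) u v = 0 :=
  hv.2 u hu

namespace LightlikeSubmanifold

variable (S : LightlikeSubmanifold F g ι) {x : M} {v a s t : TangentSpace 𝓘(ℝ, E) (ι x)}

theorem screen_le_tangent : S.screen x ≤ tangent E F ι x :=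
  le_sup_right.trans (S.screen_sup x).le

theorem inner_tangent_screenTrans {u : TangentSpace 𝓘(ℝ, E) (ι x)} (hu : u ∈ tangent E F ι x) (hv : v ∈ S.screenTrans x) :
    g.val (ι x) u v = 0 := by
  have h : v ∈ orth g (tangent E F ι x) := by
    rw [← S.screenTrans_sup x]; exact Submodule.mem_sup_right hv
  exact h u hu

theorem inner_screen_ltr {u : TangentSpace 𝓘(ℝ, E) (ι x)} (hu : u ∈ S.screen x) (hv : v ∈ S.ltr x) : g.val (ι x) u v = 0 := by
  have h : v ∈ orth g (S.screen x ⊔ S.screenTrans x) := by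
    rw [← S.ltr_sup x]; exact Submodule.mem_sup_right hv
  exact h u (Submodule.mem_sup_left hu)

theorem inner_screenTrans_ltr {u : TangentSpace 𝓘(ℝ, E) (ι x)} (hu : u ∈ S.screenTrans x) (hv : v ∈ S.ltr x) :
    g.val (ι x) u v = 0 := by
  have h : v ∈ orth g (S.screen x ⊔ S.screenTrans x) := by
    rw [← S.ltr_sup x]; exact Submodule.mem_sup_right hv
  exact h u (Submodule.mem_sup_right hu)

theorem exists_eq_add_add_add (v : TangentSpace 𝓘(ℝ, E) (ι x)) :
    ∃ a ∈ radical F g ι x, ∃ s ∈ S.screen x, ∃ l ∈ S.ltr x, ∃ t ∈ S.screenTrans x,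
      v = a + s + l + t := by
  have h : v ∈ tangent E F ι x ⊔ (S.ltr x ⊔ S.screenTrans x) := by
    rw [(S.isCompl_tangent x).sup_eq_top]; trivial
  rw [← S.screen_sup x] at h
  obtain ⟨_, h1, _, h2, rfl⟩ := Submodule.mem_sup.1 h
  obtain ⟨a, ha, s, hs, rfl⟩ := Submodule.mem_sup.1 h1
  obtain ⟨l, hl, t, ht, rfl⟩ := Submodule.mem_sup.1 h2
  exact ⟨a, ha, s, hs, l, hl, t, ht, by abel⟩

/-- `Rad TM` is orthogonal to every summand of `TN|_M` except `ltr(TM)`, so nondegeneracy of `g`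
makes its pairing with `ltr(TM)` detect zero. The next lemma is the dual statement. -/
theorem eq_zero_of_mem_radical (ha : a ∈ radical F g ι x)
    (h : ∀ u ∈ S.ltr x, g.val (ι x) a u = 0) : a = 0 := by
  refine g.nondegenerate (ι x) a fun v ↦ ?_
  obtain ⟨b, hb, s, hs, l, hl, t, ht, rfl⟩ := S.exists_eq_add_add_add v
  rw [map_add, map_add, map_add, h l hl, S.inner_tangent_screenTrans ha.1 ht,
    g.symm, inner_tangent_radical hb.1 ha, g.symm, inner_tangent_radical
      (S.screen_le_tangent hs) ha]
  simp

theorem eq_zero_of_mem_ltr (hv : v ∈ S.ltr x)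
    (h : ∀ u ∈ radical F g ι x, g.val (ι x) v u = 0) : v = 0 := by
  refine g.nondegenerate (ι x) v fun w ↦ ?_
  obtain ⟨b, hb, s, hs, l, hl, t, ht, rfl⟩ := S.exists_eq_add_add_add w
  rw [map_add, map_add, map_add, h b hb, S.ltr_null x v hv l hl, g.symm,
    S.inner_screen_ltr hs hv, g.symm, S.inner_screenTrans_ltr ht hv]
  simp

theorem exists_eq_add_add (h : ∀ u ∈ radical F g ι x, g.val (ι x) v u = 0) :
    ∃ a ∈ radical F g ι x, ∃ s ∈ S.screen x, ∃ t ∈ S.screenTrans x, v = a + s + t := by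
  obtain ⟨a, ha, s, hs, l, hl, t, ht, rfl⟩ := S.exists_eq_add_add_add v
  have hl0 : l = 0 := by
    refine S.eq_zero_of_mem_ltr hl fun u hu ↦ ?_
    have h' := h u hu
    simp only [map_add, add_apply] at h'
    rw [inner_tangent_radical ha.1 hu, inner_tangent_radical (S.screen_le_tangent hs) hu,
      g.symm _ t u, S.inner_tangent_screenTrans hu.1 ht] at h'
    simpa using h'
  exact ⟨a, ha, s, hs, t, ht, by rw [hl0, add_zero]⟩

theorem tangentPart_add (ha : a ∈ radical F g ι x) (hs : s ∈ S.screen x)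
    (ht : t ∈ S.screenTrans x) : S.tangentPart x (a + s + t) = a + s := by
  rw [tangentPart, map_add, (Submodule.projection_apply_eq_zero_iff _).2
    (Submodule.mem_sup_right ht), add_zero]
  exact Submodule.projection_apply_of_mem_left _
    (Submodule.add_mem _ ha.1 (S.screen_le_tangent hs))

theorem radicalPart_add (ha : a ∈ radical F g ι x) (hs : s ∈ S.screen x) :
    S.radicalPart x (a + s) = a := by
  rw [radicalPart, map_add, (Submodule.projection_apply_eq_zero_iff _).2
    (Submodule.mem_sup_left hs), add_zero, Submodule.projection_apply_of_mem_left _ ha]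

theorem screenPart_add (ha : a ∈ radical F g ι x) (hs : s ∈ S.screen x) :
    S.screenPart x (a + s) = s := by
  rw [screenPart, map_add, (Submodule.projection_apply_eq_zero_iff _).2
    (Submodule.mem_sup_left ha), zero_add, Submodule.projection_apply_of_mem_left _ hs]

theorem screenTransPart_add (ha : a ∈ radical F g ι x) (hs : s ∈ S.screen x)
    (ht : t ∈ S.screenTrans x) : S.screenTransPart x (a + s + t) = t := by
  rw [screenTransPart, map_add, (Submodule.projection_apply_eq_zero_iff _).2
    (Submodule.mem_sup_left (Submodule.add_mem _ ha.1 (S.screen_le_tangent hs))), zero_add,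
    Submodule.projection_apply_of_mem_left _ ht]

theorem inner_f (hs : s ∈ S.screen x) (z : TangentSpace 𝓘(ℝ, E) (ι x)) :
    g.val (ι x) s (S.f x J z) = g.val (ι x) s (J.val (ι x) z) := by
  have h : J.val (ι x) z - S.f x J z ∈ S.ltr x ⊔ S.screenTrans x :=
    Submodule.sub_projection_mem (S.isCompl_tangent x) _
  obtain ⟨l, hl, t, ht, hlt⟩ := Submodule.mem_sup.1 h
  have h1 := congrArg (g.val (ι x) s) hlt
  rw [map_add, map_sub, S.inner_screen_ltr hs hl,
    S.inner_tangent_screenTrans (S.screen_le_tangent hs) ht] at h1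
  linarith

/-- If `v = Jw` with `v`, `w` in the screen, then `Jv = J²w = 3v + w` is again in the screen. -/
theorem bronze_mem_B₀ (hv : v ∈ S.B₀ J x) : J.val (ι x) v ∈ S.B₀ J x := by
  obtain ⟨⟨w, hw, rfl⟩, hv'⟩ := hv
  refine ⟨⟨_, hv', rfl⟩, ?_⟩
  change J.val (ι x) (J.val (ι x) w) ∈ S.screen x
  rw [J.sq]
  exact Submodule.add_mem _ (Submodule.smul_mem _ _ hv') hw

end LightlikeSubmanifold

namespace ScreenGenericLightlikeSubmanifold

theorem bronze_mem_radical (S : ScreenGenericLightlikeSubmanifold F g J ι) {x : M}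
    {v : TangentSpace 𝓘(ℝ, E) (ι x)} (hv : v ∈ radical F g ι x) :
    J.val (ι x) v ∈ radical F g ι x := by
  rw [← S.radical_invariant x]
  exact ⟨v, hv, rfl⟩

variable (S : ScreenGenericLightlikeSubmanifold F g J ι) {x : M}
  {v s : TangentSpace 𝓘(ℝ, E) (ι x)}

/-- Nondegeneracy of `B₀` splits the screen as `B₀ ⊕ B'`. The `B'`-component `z` of `s` is
orthogonal to `B₀`, to `B'` and to `Rad TM`, hence to all of `TM`; so it lies in `Rad TM ∩ S(TM) =
0`. -/
theorem mem_B₀_of_inner_Bprime [FiniteDimensional ℝ E] (hs : s ∈ S.screen x)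
    (h : ∀ z ∈ S.Bprime x, g.val (ι x) s z = 0) : s ∈ S.B₀ J x := by
  have : FiniteDimensional ℝ (TangentSpace 𝓘(ℝ, E) (ι x)) := ‹FiniteDimensional ℝ E›
  let B : LinearMap.BilinForm ℝ (TangentSpace 𝓘(ℝ, E) (ι x)) :=
    (ContinuousLinearMap.coeLM ℝ).comp (g.val (ι x)).toLinearMap
  have hB : B.IsRefl := fun u v huv ↦ (g.symm (ι x) v u).trans huv
  have hc : IsCompl (S.B₀ J x) (B.orthogonal (S.B₀ J x)) := by
    rw [LinearMap.BilinForm.isCompl_orthogonal_iff_disjoint hB, disjoint_iff]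
    exact S.B₀_nondegenerate x
  have hmem : s ∈ S.B₀ J x ⊔ B.orthogonal (S.B₀ J x) := by rw [hc.sup_eq_top]; trivial
  obtain ⟨β, hβ, z, hz, rfl⟩ := Submodule.mem_sup.1 hmem
  have hzo : z ∈ orth g (S.B₀ J x) := hz
  have hzs : z ∈ S.screen x := by simpa using Submodule.sub_mem _ hs hβ.2
  have hzB : z ∈ S.Bprime x := by rw [S.Bprime_eq x]; exact ⟨hzs, hzo⟩
  have hz' : ∀ w ∈ S.Bprime x, g.val (ι x) z w = 0 := by
    intro w hw
    have h1 := h w hw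
    rw [S.Bprime_eq x] at hw
    rwa [map_add, add_apply, hw.2 β hβ, zero_add] at h1
  have hzrad : z ∈ radical F g ι x := by
    refine ⟨S.screen_le_tangent hzs, fun w hw ↦ ?_⟩
    rw [← S.screen_sup x] at hw
    obtain ⟨r, hr, q, hq, rfl⟩ := Submodule.mem_sup.1 hw
    have hmem' : q ∈ S.B₀ J x ⊔ B.orthogonal (S.B₀ J x) := by rw [hc.sup_eq_top]; trivial
    obtain ⟨γ, hγ, y, hy, rfl⟩ := Submodule.mem_sup.1 hmem'
    have hyB : y ∈ S.Bprime x := by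
      rw [S.Bprime_eq x]
      exact ⟨by simpa using Submodule.sub_mem _ hq hγ.2, hy⟩
    rw [map_add, map_add, add_apply, add_apply, hzo γ hγ, g.symm _ y z, hz' y hyB,
      g.symm _ r z, inner_tangent_radical (S.screen_le_tangent hzs) hr]
    simp
  have hz0 : z ∈ radical F g ι x ⊓ S.screen x := ⟨hzrad, hzs⟩
  rw [S.screen_inf x, Submodule.mem_bot] at hz0
  rwa [hz0, add_zero]

/-- For `w = J v + β` with `v` tangent and `β ∈ B₀`, membership `v ∈ B₀` is detected by the
`Rad TM`-, `S(TM)`- and `S(TM^⊥)`-parts of `w`. -/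
theorem mem_B₀_iff [FiniteDimensional ℝ E] {β w : TangentSpace 𝓘(ℝ, E) (ι x)}
    (hv : v ∈ tangent E F ι x) (hβ : β ∈ S.B₀ J x) (hw : w = J.val (ι x) v + β) :
    v ∈ S.B₀ J x ↔
      (∀ u ∈ S.ltr x, g.val (ι x) (S.radicalPart x (S.tangentPart x w)) (J.val (ι x) u)
        = 3 * g.val (ι x) (S.radicalPart x (S.tangentPart x w)) u) ∧
      (∀ z ∈ S.Bprime x, g.val (ι x) (S.screenPart x (S.tangentPart x w)) (S.f x J z)
          + g.val (ι x) (S.screenTransPart x w) (J.val (ι x) z)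
        = 3 * g.val (ι x) (S.screenPart x (S.tangentPart x w)) z) := by
  -- Orthogonality to the radical means that `w` has no `ltr(TM)`-part.
  have hwrad : ∀ u ∈ radical F g ι x, g.val (ι x) w u = 0 := by
    intro u hu
    rw [hw, map_add, add_apply, ← J.compatible,
      inner_tangent_radical hv (S.bronze_mem_radical hu),
      inner_tangent_radical (S.screen_le_tangent hβ.2) hu, add_zero]
  obtain ⟨a, ha, s, hs, t, ht, hast⟩ := S.exists_eq_add_add hwrad
  rw [hast, S.tangentPart_add ha hs ht, S.radicalPart_add ha hs, S.screenPart_add ha hs,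
    S.screenTransPart_add ha hs ht]
  -- Both expressions for `w` are paired with `(J - 3)z`. Since `J(J - 3) = I`, the term `Jv`
  -- contributes `g(v, z)`; `β` contributes nothing because `z` is orthogonal to the `J`-invariant
  -- `B₀`, and neither does `a`, as `Rad TM` is `J`-invariant and orthogonal to `z`.
  have hz : ∀ z ∈ S.Bprime x, g.val (ι x) s (S.f x J z) + g.val (ι x) t (J.val (ι x) z)
      - 3 * g.val (ι x) s z = g.val (ι x) v z := by
    intro z hz
    rw [S.Bprime_eq x] at hz
    have hzt := S.screen_le_tangent hz.1
    have h1 := congrArg (fun y ↦ g.val (ι x) y (J.val (ι x) z - (3 : ℝ) • z)) (hast.symm.trans hw)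
    simp only [map_add, map_sub, map_smul, add_apply, smul_eq_mul] at h1
    rw [J.compatible _ a z, J.compatible _ β z, ← J.compatible _ v (J.val (ι x) z), J.sq,
      g.symm _ (J.val (ι x) a) z, inner_tangent_radical hzt (S.bronze_mem_radical ha),
      g.symm _ a z, inner_tangent_radical hzt ha, g.symm _ t z,
      S.inner_tangent_screenTrans hzt ht, hz.2 _ hβ, hz.2 _ (S.bronze_mem_B₀ hβ), map_add,
      map_smul, smul_eq_mul, ← J.compatible _ v z] at h1
    rw [S.inner_f hs]
    linarith
  constructor
  · intro hvB
    have hwB : w ∈ S.B₀ J x := hw ▸ Submodule.add_mem _ (S.bronze_mem_B₀ hvB) hβ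
    -- Here `w` lies in the screen, so its radical part vanishes.
    have ha0 : a = 0 := by
      have h1 := S.tangentPart_add (Submodule.zero_mem _) hwB.2 (Submodule.zero_mem _)
      have h2 := S.radicalPart_add (Submodule.zero_mem _) hwB.2
      rw [zero_add, add_zero] at h1
      rw [zero_add] at h2
      rw [← S.radicalPart_add ha hs, ← S.tangentPart_add ha hs ht, ← hast, h1, h2]
    refine ⟨fun u _ ↦ by simp [ha0], fun z hz' ↦ ?_⟩
    have h1 := hz z hz'
    rw [S.Bprime_eq x] at hz'
    rw [hz'.2 v hvB] at h1
    linarith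
  · rintro ⟨h1, h2⟩
    have hJa : J.val (ι x) a - (3 : ℝ) • a = 0 := by
      refine S.eq_zero_of_mem_radical
        (Submodule.sub_mem _ (S.bronze_mem_radical ha) (Submodule.smul_mem _ _ ha)) fun u hu ↦ ?_
      simp only [map_sub, map_smul, sub_apply, smul_apply, smul_eq_mul]
      rw [← J.compatible, h1 u hu, sub_self]
    -- Applying `J` to `Ja - 3a = 0` leaves `a = 0`, because `J² - 3J = I`.
    have ha0 : a = 0 := by
      have h3 := congrArg (J.val (ι x)) hJa
      rw [map_sub, J.sq, map_smul, map_zero] at h3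
      simpa using h3
    have hvt := hv
    rw [← S.screen_sup x] at hvt
    obtain ⟨ξ, hξ, σ, hσ, rfl⟩ := Submodule.mem_sup.1 hvt
    have hσB : σ ∈ S.B₀ J x := by
      refine S.mem_B₀_of_inner_Bprime hσ fun z hz' ↦ ?_
      have h3 := hz z hz'
      have h4 := h2 z hz'
      rw [S.Bprime_eq x] at hz'
      rw [map_add, add_apply, g.symm _ ξ z,
        inner_tangent_radical (S.screen_le_tangent hz'.1) hξ] at h3
      linarith
    -- Once `σ ∈ B₀`, the vector `Jσ + β` is in the screen, so `Jξ` is the radical part of `w`,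
    -- which is `a = 0`.
    have hJξ : J.val (ι x) ξ = 0 := by
      have h3 : (J.val (ι x) σ + β) ∈ S.screen x :=
        (Submodule.add_mem _ (S.bronze_mem_B₀ hσB) hβ).2
      have h4 : w = J.val (ι x) ξ + (J.val (ι x) σ + β) + 0 := by rw [hw, map_add]; abel
      rw [← S.radicalPart_add (S.bronze_mem_radical hξ) h3,
        ← S.tangentPart_add (S.bronze_mem_radical hξ) h3 (Submodule.zero_mem _), ← h4, hast,
        S.tangentPart_add ha hs ht, S.radicalPart_add ha hs, ha0]
    have hξ0 : ξ = 0 := by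
      have h3 := J.sq (ι x) ξ
      rw [hJξ] at h3
      simpa using h3.symm
    rwa [hξ0, zero_add]

end ScreenGenericLightlikeSubmanifold

end Pointwise

/-! ### The bracket through the `(l, m)`-type connection -/

section Main
variable {E : Type*} [NormedAddCommGroup E] [NormedSpace ℝ E] [FiniteDimensional ℝ E]
  {N : Type*} [TopologicalSpace N] [ChartedSpace E N] [IsManifold 𝓘(ℝ, E) ∞ N]
  {F : Type*} [NormedAddCommGroup F] [NormedSpace ℝ F] [CompleteSpace F]
  {M : Type*} [TopologicalSpace M] [ChartedSpace F M] [IsManifold 𝓘(ℝ, F) ∞ M]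

/-- `J` passes through the parallel connection `D`, whose vanishing torsion then produces the
bracket. The remainder is written in `X`, `Y`, `JX`, `JY` so that it visibly lies in `B₀` when `X`
and `Y` do. -/
theorem covAlong_lmConnection_pushJ_sub {g : SemiRiemannianMetric E N} (J : BronzeStructure g)
    {D : LinearConnection E N} (hD : D.torsion = 0) (hJ : IsParallel D J)
    (η : ∀ p : N, TangentSpace 𝓘(ℝ, E) p) (l m : N → ℝ) {ι : M → N}
    (hι : ContMDiff 𝓘(ℝ, F) 𝓘(ℝ, E) ∞ ι) {X Y : ∀ x : M, TangentSpace 𝓘(ℝ, F) x}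
    (hX : ContMDiff 𝓘(ℝ, F) 𝓘(ℝ, F).tangent ∞
      (fun x ↦ (⟨x, X x⟩ : TangentBundle 𝓘(ℝ, F) M)))
    (hY : ContMDiff 𝓘(ℝ, F) 𝓘(ℝ, F).tangent ∞
      (fun x ↦ (⟨x, Y x⟩ : TangentBundle 𝓘(ℝ, F) M))) (x : M) :
    covAlong (lmConnection g J D η l m) ι (pushJ J ι Y) x (X x)
        - covAlong (lmConnection g J D η l m) ι (pushJ J ι X) x (Y x)
      = J.val (ι x) (push E ι (VectorField.mlieBracket 𝓘(ℝ, F) X Y) x)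
        + (g.val (ι x) (η (ι x)) (pushJ J ι Y x)
            • (l (ι x) • push E ι X x + m (ι x) • pushJ J ι X x)
          - g.val (ι x) (η (ι x)) (pushJ J ι X x)
            • (l (ι x) • push E ι Y x + m (ι x) • pushJ J ι Y x)) := by
  have h1 := covAlong_bronze J hJ hι (contMDiff_push hι hY).contMDiffAt (X x)
  have h2 := covAlong_bronze J hJ hι (contMDiff_push hι hX).contMDiffAt (Y x)
  rw [← covAlong_push_sub hD hι hX.contMDiffAt hY.contMDiffAt (contMDiff_push hι hX).contMDiffAt
    (contMDiff_push hι hY).contMDiffAt, covAlong_lmConnection, covAlong_lmConnection, map_sub,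
    ← h1, ← h2]
  exact add_sub_add_comm _ _ _ _

end Main

end Bronze

end

/-! ### The integrability criterion -/

theorem mainTheorem4
    -- the ambient manifold `N` and the submanifold `M`, immersed by `ι`
    {E : Type*} [NormedAddCommGroup E] [NormedSpace ℝ E] [FiniteDimensional ℝ E]
    {N : Type*} [TopologicalSpace N] [T2Space N] [ChartedSpace E N] [IsManifold 𝓘(ℝ, E) ∞ N]
    {F : Type*} [NormedAddCommGroup F] [NormedSpace ℝ F] [FiniteDimensional ℝ F]
    {M : Type*} [TopologicalSpace M] [T2Space M] [ChartedSpace F M] [IsManifold 𝓘(ℝ, F) ∞ M]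
    -- the locally bronze semi-Riemannian structure, with Levi-Civita connection `D`
    (g : Bronze.SemiRiemannianMetric E N) (J : Bronze.BronzeStructure g)
    (D : Bronze.LinearConnection E N) (hD : Bronze.IsLeviCivita g D)
    (hJ : Bronze.IsParallel D J)
    -- the data of the `(l, m)`-type connection
    (η : ∀ p : N, TangentSpace 𝓘(ℝ, E) p)
    (hη : ContMDiff 𝓘(ℝ, E) 𝓘(ℝ, E).tangent ∞
      (fun p ↦ (⟨p, η p⟩ : TangentBundle 𝓘(ℝ, E) N)))
    (hη_unit : ∀ p, g.val p (η p) (η p) = 1)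
    (l m : N → ℝ) (hl : ContMDiff 𝓘(ℝ, E) 𝓘(ℝ) ∞ l) (hm : ContMDiff 𝓘(ℝ, E) 𝓘(ℝ) ∞ m)
    (hlm : (l, m) ≠ (0, 0))
    -- the screen generic lightlike submanifold
    (ι : M → N) (S : Bronze.ScreenGenericLightlikeSubmanifold F g J ι) :
    let Ω := Bronze.lmConnection g J D η l m
    let Jp := Bronze.pushJ (F := F) J ι
    Bronze.IsIntegrable F ι (S.B₀ J) ↔
      (∀ X Y : ∀ x : M, TangentSpace 𝓘(ℝ, F) x,
        Bronze.IsTangentSection ι (S.B₀ J) X → Bronze.IsTangentSection ι (S.B₀ J) Y →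
        ∀ U, Bronze.IsSection F ι S.ltr U → ∀ x,
          g.val (ι x) (S.radicalForm x Ω X (Jp Y)) (J.val (ι x) (U x))
              + 3 * g.val (ι x) (S.radicalForm x Ω Y (Jp X)) (U x)
            = g.val (ι x) (S.radicalForm x Ω Y (Jp X)) (J.val (ι x) (U x))
              + 3 * g.val (ι x) (S.radicalForm x Ω X (Jp Y)) (U x)) ∧
      (∀ X Y : ∀ x : M, TangentSpace 𝓘(ℝ, F) x,
        Bronze.IsTangentSection ι (S.B₀ J) X → Bronze.IsTangentSection ι (S.B₀ J) Y →
        ∀ Z, Bronze.IsSection F ι S.Bprime Z → ∀ x,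
          g.val (ι x) (S.screenConnection x Ω X (Jp Y)) (S.f x J (Z x))
              + g.val (ι x) (S.screenSecondForm x Ω X (Jp Y)) (J.val (ι x) (Z x))
              + 3 * g.val (ι x) (S.screenConnection x Ω Y (Jp X)) (Z x)
            = g.val (ι x) (S.screenConnection x Ω Y (Jp X)) (S.f x J (Z x))
              + g.val (ι x) (S.screenSecondForm x Ω Y (Jp X)) (J.val (ι x) (Z x))
              + 3 * g.val (ι x) (S.screenConnection x Ω X (Jp Y)) (Z x)) := by
  intro Ω Jp
  have hι : ContMDiff 𝓘(ℝ, F) 𝓘(ℝ, E) ∞ ι := S.isImmersion.contMDiff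
  -- The equivalence already holds for fixed `X`, `Y` at each point, with single vectors `u`, `z` in
  -- place of sections.
  have key : ∀ X Y : ∀ x : M, TangentSpace 𝓘(ℝ, F) x,
      Bronze.IsTangentSection ι (S.B₀ J) X → Bronze.IsTangentSection ι (S.B₀ J) Y → ∀ x,
      (Bronze.push E ι (VectorField.mlieBracket 𝓘(ℝ, F) X Y) x ∈ S.B₀ J x ↔
        (∀ u ∈ S.ltr x,
          g.val (ι x) (S.radicalForm x Ω X (Jp Y)) (J.val (ι x) u)
              + 3 * g.val (ι x) (S.radicalForm x Ω Y (Jp X)) u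
            = g.val (ι x) (S.radicalForm x Ω Y (Jp X)) (J.val (ι x) u)
              + 3 * g.val (ι x) (S.radicalForm x Ω X (Jp Y)) u) ∧
        (∀ z ∈ S.Bprime x,
          g.val (ι x) (S.screenConnection x Ω X (Jp Y)) (S.f x J z)
              + g.val (ι x) (S.screenSecondForm x Ω X (Jp Y)) (J.val (ι x) z)
              + 3 * g.val (ι x) (S.screenConnection x Ω Y (Jp X)) z
            = g.val (ι x) (S.screenConnection x Ω Y (Jp X)) (S.f x J z)
              + g.val (ι x) (S.screenSecondForm x Ω Y (Jp X)) (J.val (ι x) z)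
              + 3 * g.val (ι x) (S.screenConnection x Ω X (Jp Y)) z)) := by
    intro X Y hX hY x
    have hβ := Submodule.sub_mem _
      (Submodule.smul_mem _ (g.val (ι x) (η (ι x)) (Bronze.pushJ J ι Y x)) (Submodule.add_mem _
        (Submodule.smul_mem _ (l (ι x)) (hX.2 x))
        (Submodule.smul_mem _ (m (ι x)) (S.bronze_mem_B₀ (hX.2 x)))))
      (Submodule.smul_mem _ (g.val (ι x) (η (ι x)) (Bronze.pushJ J ι X x)) (Submodule.add_mem _
        (Submodule.smul_mem _ (l (ι x)) (hY.2 x))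
        (Submodule.smul_mem _ (m (ι x)) (S.bronze_mem_B₀ (hY.2 x)))))
    have htan : Bronze.push E ι (VectorField.mlieBracket 𝓘(ℝ, F) X Y) x ∈
        Bronze.tangent E F ι x := LinearMap.mem_range_self _ _
    refine (S.mem_B₀_iff htan hβ (Bronze.covAlong_lmConnection_pushJ_sub J hD.torsion_free hJ
      η l m hι hX.1 hY.1 x)).trans ?_
    -- The projections are linear, so each part of `w` is the difference of the corresponding parts
    -- of `Ω_X JY` and `Ω_Y JX`; the criterion is then (i) and (ii) with terms rearranged.
    simp only [map_sub, sub_apply]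
    refine and_congr (forall₂_congr fun u _ ↦ ?_) (forall₂_congr fun z _ ↦ ?_)
    · change g.val (ι x) (S.radicalForm x Ω X (Jp Y)) (J.val (ι x) u)
          - g.val (ι x) (S.radicalForm x Ω Y (Jp X)) (J.val (ι x) u)
        = 3 * (g.val (ι x) (S.radicalForm x Ω X (Jp Y)) u
          - g.val (ι x) (S.radicalForm x Ω Y (Jp X)) u) ↔ _
      constructor <;> intro h <;> linarith
    · change g.val (ι x) (S.screenConnection x Ω X (Jp Y)) (S.f x J z)
          - g.val (ι x) (S.screenConnection x Ω Y (Jp X)) (S.f x J z)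
          + (g.val (ι x) (S.screenSecondForm x Ω X (Jp Y)) (J.val (ι x) z)
          - g.val (ι x) (S.screenSecondForm x Ω Y (Jp X)) (J.val (ι x) z))
        = 3 * (g.val (ι x) (S.screenConnection x Ω X (Jp Y)) z
          - g.val (ι x) (S.screenConnection x Ω Y (Jp X)) z) ↔ _
      constructor <;> intro h <;> linarith
  constructor
  · intro h
    exact ⟨fun X Y hX hY U hU x ↦ ((key X Y hX hY x).1 (h X Y hX hY x)).1 _ (hU.2 x),
      fun X Y hX hY Z hZ x ↦ ((key X Y hX hY x).1 (h X Y hX hY x)).2 _ (hZ.2 x)⟩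
  · rintro ⟨h1, h2⟩ X Y hX hY x
    refine (key X Y hX hY x).2 ⟨fun u hu ↦ ?_, fun z hz ↦ ?_⟩
    · obtain ⟨U, hU, rfl⟩ := Bronze.exists_isSection_apply_eq hι S.ltr_subbundle hu
      exact h1 X Y hX hY U hU x
    · obtain ⟨k, hk⟩ := S.Bprime_subbundle
      obtain ⟨Z, hZ, rfl⟩ := Bronze.exists_isSection_apply_eq hι hk hz
      exact h2 X Y hX hY Z hZ x
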